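/- Let $n\ge 3$ and $[n]=\{1,\dots,n\}$. Let $\Pi_n$ be the lattice of partitions of $[n]$, where $X\le Y$ if $X$ refines $Y$; $\hat 0$ and $\hat 1$ are its minimum and maximum. An element $X>\hat 0$ is irreducible if the interval $[\hat 0,X]$ is not isomorphic to a product of two posets with more than one element each; $\mathcal I$ is the set of irreducible elements, and $F_{\mathcal I}(X)$ is the set of maximal elements of $\{Y\in\mathcal I: Y\le X\}$. The order complex $\Delta(\Pi_n)$ consists of the nonempty chains in $\Pi_n\setminus\{\hat 0,\hat 1\}$. Consider rooted trees with $n$ leaves labelled by $[n]$, whose root has degree at least $2$ and whose internal vertices (vertices other than the root and the leaves) have degree at least $3$; an internal edge is an edge not adjacent to a leaf. A combinatorial type is a class of such trees up to isomorphism preserving root and labels. The complex of trees $T_n$ is the abstract simplicial complex whose vertices are the combinatorial types of trees with exactly one internal edge and whose maximal simplices correspond to the binary trees (root of degree $2$, internal vertices of degree $3$): the vertices of the simplex of a binary tree are the types obtained from it by contracting all internal edges but one. Thus the faces of a simplex correspond to the trees obtained by contracting internal edges while keeping at least one. Identify a vertex of $T_n$, given by a tree with one internal edge and internal vertex $t$,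 with the partition in $\Pi_n$ whose only nontrivial block is the set of labels of the leaves below $t$. This identification is injective. For a simplex $F$ of an abstract simplicial complex $K$ and a new vertex $v$, the stellar subdivision of $K$ in $F$ with new vertex $v$ consists of the simplices of $K$ that do not contain $F$ and the simplices $\tau\cup\{v\}$ for all (possibly empty) $\tau\not\supseteq F$ with $\tau\cup F\in K$. Then $\Delta(\Pi_n)$ is obtained from $T_n$ by a sequence of stellar subdivisions. Explicitly, let $X_1,\dots,X_m$ be any linear extension of the opposite order on $\Pi_n\setminus(\mathcal I\cup\{\hat 0\})$, i.e. a listing of its elements such that $X_i>X_j$ implies $i<j$ (such listings exist). Then, starting with $T_n$ and performing for $i=1,\dots,m$ the stellar subdivision in $F_{\mathcal I}(X_i)$ with new vertex $X_i$, each $F_{\mathcal I}(X_i)$ is a simplex and $X_i$ is not a vertex of the complex reached before step $i$, and the final complex is equal to $\Delta(\Pi_n)$. -/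

import Mathlib

/-! ### Rooted trees with labelled leaves and the complex of trees -/

/-- A rooted tree with `n` leaves labelled by `Fin n`: a finite tree in which the vertices of
degree one are exactly the labelled leaves, the root has degree at least two, and every other
vertex that is not a leaf has degree at least three. -/
structure LabelledTree (n : ℕ) where
  V : Type
  finite : Finite V
  graph : SimpleGraph V
  isTree : graph.IsTree
  root : V
  leaf : Fin n → V
  leaf_injective : Function.Injective leaf
  degree_eq_one_iff : ∀ v, (graph.neighborSet v).ncard = 1 ↔ v ∈ Set.range leaf
  two_le_degree_root : 2 ≤ (graph.neighborSet root).ncard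
  three_le_degree : ∀ v, v ≠ root → v ∉ Set.range leaf → 3 ≤ (graph.neighborSet v).ncard

namespace LabelledTree

variable {n : ℕ}

/-- The vertices of a tree that are leaves. -/
def IsLeaf (T : LabelledTree n) (v : T.V) : Prop := v ∈ Set.range T.leaf

/-- Internal vertices: neither a leaf nor the root. -/
def IsInternal (T : LabelledTree n) (v : T.V) : Prop := v ≠ T.root ∧ ¬ T.IsLeaf v

/-- Internal edges: edges that are not adjacent to a leaf. -/
def internalEdges (T : LabelledTree n) : Set (Sym2 T.V) :=
  {e | e ∈ T.graph.edgeSet ∧ ∀ v ∈ e, ¬ T.IsLeaf v}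

/-- A rooted tree is binary if its root has degree two and its internal vertices have degree
three. -/
def IsBinary (T : LabelledTree n) : Prop :=
  (T.graph.neighborSet T.root).ncard = 2 ∧
    ∀ v, T.IsInternal v → (T.graph.neighborSet v).ncard = 3

/-- The labels of the leaves below `t`, i.e. of those leaves whose path to the root runs
through `t`. -/
def leavesBelow (T : LabelledTree n) (t : T.V) : Set (Fin n) :=
  {i | ∃ p : T.graph.Path (T.leaf i) T.root, t ∈ p.1.support}

/-- Isomorphism of trees preserving the root and the labels. As no vertex other than the root has
degree two, this is the same as the existence of a root- and label-preserving homeomorphism. -/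
def Iso (T U : LabelledTree n) : Prop :=
  ∃ e : T.graph ≃g U.graph, e T.root = U.root ∧ ∀ i, e (T.leaf i) = U.leaf i

/-- `U` is obtained from `T` by contracting a (possibly empty) set of internal edges. The vertices
of `U` are the classes of vertices of `T` that are merged by the contraction `f`. -/
def IsContraction (T U : LabelledTree n) : Prop :=
  ∃ f : T.V → U.V,
    Function.Surjective f ∧ f T.root = U.root ∧ (∀ i, f (T.leaf i) = U.leaf i) ∧
    (∀ x y, T.graph.Adj x y → f x = f y → s(x, y) ∈ T.internalEdges) ∧
    (∀ u, (T.graph.induce (f ⁻¹' {u})).Preconnected) ∧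
    (∀ a b, U.graph.Adj a b ↔ a ≠ b ∧ ∃ x y, f x = a ∧ f y = b ∧ T.graph.Adj x y)

instance setoid (n : ℕ) : Setoid (LabelledTree n) where
  r := Iso
  iseqv :=
    { refl := fun _ => ⟨SimpleGraph.Iso.refl, rfl, fun _ => rfl⟩
      symm := by
        rintro T U ⟨e, hr, hl⟩
        refine ⟨e.symm, ?_, fun i => ?_⟩
        · rw [← hr]; exact e.symm_apply_apply _
        · rw [← hl]; exact e.symm_apply_apply _
      trans := by
        rintro T U W ⟨e, hr, hl⟩ ⟨e', hr', hl'⟩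
        refine ⟨e.trans e', ?_, fun i => ?_⟩
        · change e' (e T.root) = W.root
          rw [hr, hr']
        · change e' (e (T.leaf i)) = W.leaf i
          rw [hl, hl'] }

end LabelledTree

/-- Combinatorial types of rooted trees with `n` labelled leaves. -/
def TreeType (n : ℕ) : Type 1 := Quotient (LabelledTree.setoid n)

/-- The combinatorial type of a tree. -/
def LabelledTree.type {n : ℕ} (T : LabelledTree n) : TreeType n := Quotient.mk _ T

/-- The vertices of the simplex that belongs to `T`: the combinatorial types of the trees that are
obtained from `T` by contracting all internal edges but one. -/
def LabelledTree.simplex {n : ℕ} (T : LabelledTree n) : Set (TreeType n) :=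
  {x | ∃ U : LabelledTree n, T.IsContraction U ∧ U.internalEdges.ncard = 1 ∧ U.type = x}

/-- The complex of trees: the abstract simplicial complex on the combinatorial types of trees with
one internal edge whose maximal simplices are the simplices of the binary trees. Passing to the
face spanned by a nonempty subset of the vertices of a simplex is the same as contracting the
internal edges that correspond to the other vertices. -/
def treeComplex (n : ℕ) : PreAbstractSimplicialComplex (TreeType n) where
  faces := {s | s.Nonempty ∧ ∃ B : LabelledTree n, B.IsBinary ∧ (s : Set (TreeType n)) ⊆ B.simplex}
  isRelLowerSet_faces := by
    rintro s ⟨hs, B, hB, hsB⟩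
    exact ⟨hs, fun t hts ht => ⟨ht, B, hB, (Finset.coe_subset.2 hts).trans hsB⟩⟩

/-! ### Lattices: irreducible elements, factors, order complex -/

/-- `X` is irreducible if it is not the minimum and the lower interval `[⊥, X]` is not isomorphic
to a product of two posets with more than one element each. -/
def IsIrreducibleElement.{u} {L : Type u} [PartialOrder L] [OrderBot L] (X : L) : Prop :=
  X ≠ ⊥ ∧ ∀ (A B : Type u) [PartialOrder A] [PartialOrder B] [Nontrivial A] [Nontrivial B],
    IsEmpty (Set.Icc (⊥ : L) X ≃o A × B)

/-- The set of factors of `X` with respect to the irreducible elements: the maximal elements among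
the irreducible elements below `X`. -/
noncomputable def irreducibleFactors {L : Type*} [PartialOrder L] [OrderBot L] [Finite L] (X : L) :
    Finset L :=
  (Set.toFinite {Y : L | Maximal (fun Z => IsIrreducibleElement Z ∧ Z ≤ X) Y}).toFinset

/-- The order complex of the proper part of a bounded poset. -/
def orderComplex (L : Type*) [PartialOrder L] [BoundedOrder L] : PreAbstractSimplicialComplex L where
  faces := {s | s.Nonempty ∧ ⊥ ∉ s ∧ ⊤ ∉ s ∧ IsChain (· ≤ ·) (s : Set L)}
  isRelLowerSet_faces := by
    rintro s ⟨hs, hb, ht, hc⟩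
    exact ⟨hs, fun t hts hn => ⟨hn, fun h => hb (hts h), fun h => ht (hts h),
      hc.mono (Finset.coe_subset.2 hts)⟩⟩

/-- `l` lists all elements other than the minimum that are not irreducible, each of them once, as a
linear extension of the opposite order: larger elements come first. -/
def IsOppositeLinearExtension {L : Type*} [PartialOrder L] [OrderBot L] (l : List L) : Prop :=
  l.Nodup ∧ (∀ X, X ∈ l ↔ X ≠ ⊥ ∧ ¬ IsIrreducibleElement X) ∧ l.Pairwise (fun X Y => ¬ X < Y)

/-- The partition lattice: equivalence relations on `Fin n`; `X ≤ Y` if `X` refines `Y`. -/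
abbrev PartitionLattice (n : ℕ) : Type := Setoid (Fin n)

instance (n : ℕ) : Finite (PartitionLattice n) :=
  Finite.of_injective (fun X : Setoid (Fin n) => fun i j => X i j) fun _ _ h =>
    Setoid.ext fun i j => iff_of_eq (congrFun (congrFun h i) j)

/-- The partition with block `A` and all other blocks singletons. -/
@[reducible]
def blockPartition {n : ℕ} (A : Set (Fin n)) : PartitionLattice n where
  r i j := i = j ∨ (i ∈ A ∧ j ∈ A)
  iseqv :=
    { refl := fun _ => Or.inl rfl
      symm := by
        rintro i j (rfl | ⟨hi, hj⟩)
        · exact Or.inl rfl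
        · exact Or.inr ⟨hj, hi⟩
      trans := by
        rintro i j k (rfl | ⟨hi, hj⟩) (rfl | ⟨hj', hk⟩)
        · exact Or.inl rfl
        · exact Or.inr ⟨hj', hk⟩
        · exact Or.inr ⟨hi, hj⟩
        · exact Or.inr ⟨hi, hk⟩ }

/-! ### Stellar subdivisions -/

open Classical in
/-- The complex obtained from `K` by renaming the vertices by `f`. -/
noncomputable def PreAbstractSimplicialComplex.relabel {α β : Type*}
    (K : PreAbstractSimplicialComplex α) (f : α → β) : PreAbstractSimplicialComplex β :=
  K.map f

open Classical in
/-- The stellar subdivision of `K` in the simplex `F` with new vertex `v`: the simplices that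
contain `F` are removed, and for each `τ` (possibly empty) that does not contain `F` and for which
`τ ∪ F` is a simplex of `K`, the simplex `τ ∪ {v}` is added. -/
def PreAbstractSimplicialComplex.stellar {α : Type*} (K : PreAbstractSimplicialComplex α)
    (F : Finset α) (v : α) : PreAbstractSimplicialComplex α where
  faces := {s | s ∈ K.faces ∧ ¬ F ⊆ s} ∪ {s | ∃ τ, ¬ F ⊆ τ ∧ τ ∪ F ∈ K.faces ∧ s = insert v τ}
  isRelLowerSet_faces := by
    rintro s (⟨hs, hF⟩ | ⟨τ, hF, hτ, rfl⟩)
    · have h := K.isRelLowerSet_faces hs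
      exact ⟨h.1, fun t hts ht => Or.inl ⟨h.2 hts ht, fun hFt => hF (hFt.trans hts)⟩⟩
    · have h := K.isRelLowerSet_faces hτ
      refine ⟨Finset.insert_nonempty _ _, fun t hts ht => ?_⟩
      by_cases hv : v ∈ t
      · have hsub : t.erase v ⊆ τ := by
          intro x hx
          have hx' := Finset.mem_erase.1 hx
          exact (Finset.mem_insert.1 (hts hx'.2)).resolve_left hx'.1
        have hne : F.Nonempty := by
          rw [Finset.nonempty_iff_ne_empty]
          rintro rfl
          exact hF (Finset.empty_subset _)
        refine Or.inr ⟨t.erase v, fun h' => hF (h'.trans hsub), ?_, (Finset.insert_erase hv).symm⟩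
        exact h.2 (Finset.union_subset_union_left hsub) (hne.mono Finset.subset_union_right)
      · have hsub : t ⊆ τ := fun x hx =>
          (Finset.mem_insert.1 (hts hx)).resolve_left (fun hxv => hv (hxv ▸ hx))
        exact Or.inl ⟨h.2 (hsub.trans Finset.subset_union_left) ht, fun h' => hF (h'.trans hsub)⟩

/-- `IsStellarSequence K l K'`: successive stellar subdivision of `K` in the simplices `F` with the
new vertices `v`, for the pairs `(F, v)` in the list `l` in their order, is possible and ends in
`K'`. At each step `F` has to be a simplex and `v` must not be a vertex of the complex reached. -/
inductive IsStellarSequence {α : Type*} : PreAbstractSimplicialComplex α → List (Finset α × α) →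
    PreAbstractSimplicialComplex α → Prop
  | nil (K) : IsStellarSequence K [] K
  | cons (K K' F v l) : F ∈ K.faces → {v} ∉ K.faces → IsStellarSequence (K.stellar F v) l K' →
      IsStellarSequence K ((F, v) :: l) K'

/-! ### Nested sets and stellar subdivisions -/

section Nested

variable {L : Type*}

/-! For a set `G` of elements of a lattice, the nested sets are the finite sets of elements of `G`
other than `⊤` in which no antichain with at least two members has its join in `G`. Both complexes
of the theorem are complexes of nested sets. If `G` is everything except `⊥`, two incomparable
elements are already forbidden, so the nested sets are chains and form the order complex. If `G` is
the set of irreducible partitions, which are those with one nontrivial block, the nested sets are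
the laminar families of proper blocks (`isNested_irreducible_iff`), and these are the faces of the
complex of trees (`mem_faces_relabel_treeComplex`).

To pass from the second `G` to the first, the missing elements are adjoined from the top down. When
`X` is adjoined, all elements above `X` are in `G`, while the elements of `G` below `X` are
irreducible. Under these conditions the stellar subdivision in the factors of `X` turns the nested
sets of `G` into those of `insert X G` (`IsBuildingStep.stellar_faces`);
`isStellarSequence_orderComplex` iterates this. The lattice enters only through `HasFactorization`:
a representation of `X` as a join of irreducibles splits along the factors of `X`.

For the trees, a contraction to one internal edge cuts off a connected vertex set with connected
complement, and in a tree such sets avoiding the root are laminar. Conversely, a laminar family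
extends to a maximal one containing the singletons and the whole set, and joining each member to its
parent gives a binary tree. -/

theorem exists_antichain_same_sSup [CompleteLattice L] [Finite L] (s : Finset L) :
    ∃ a ⊆ s, IsAntichain (· ≤ ·) (a : Set L) ∧ sSup (a : Set L) = sSup (s : Set L) ∧
      ∀ x ∈ s, ∃ y ∈ a, x ≤ y := by
  classical
  have hle : ∀ x ∈ s, ∃ y ∈ s.filter (fun x => Maximal (· ∈ s) x), x ≤ y := by
    intro x hx
    obtain ⟨y, hxy, hy⟩ := s.exists_le_maximal hx
    exact ⟨y, Finset.mem_filter.2 ⟨hy.prop, hy⟩, hxy⟩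
  refine ⟨s.filter (fun x => Maximal (· ∈ s) x), Finset.filter_subset _ _, ?_, ?_, hle⟩
  · intro x hx y hy hxy h
    have hx' := (Finset.mem_filter.1 hx).2
    have hy' := (Finset.mem_filter.1 hy).2
    exact hxy (le_antisymm h (hx'.2 hy'.prop h))
  · apply le_antisymm
    · exact sSup_le_sSup (Finset.coe_subset.2 (Finset.filter_subset _ _))
    · refine sSup_le fun x hx => ?_
      obtain ⟨y, hy, hxy⟩ := hle x hx
      exact hxy.trans (le_sSup hy)

theorem mem_irreducibleFactors [PartialOrder L] [OrderBot L] [Finite L] {X Y : L} :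
    Y ∈ irreducibleFactors X ↔ Maximal (fun Z => IsIrreducibleElement Z ∧ Z ≤ X) Y := by
  simp [irreducibleFactors]

theorem exists_le_mem_irreducibleFactors [PartialOrder L] [OrderBot L] [Finite L] {X Z : L}
    (hZ : IsIrreducibleElement Z) (h : Z ≤ X) : ∃ k ∈ irreducibleFactors X, Z ≤ k := by
  obtain ⟨k, hk, hm⟩ := exists_maximal_ge_of_wellFoundedGT
    (fun Z => IsIrreducibleElement Z ∧ Z ≤ X) Z ⟨hZ, h⟩
  exact ⟨k, mem_irreducibleFactors.2 hm, hk⟩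

theorem isAntichain_irreducibleFactors [PartialOrder L] [OrderBot L] [Finite L] (X : L) :
    IsAntichain (· ≤ ·) (irreducibleFactors X : Set L) := by
  intro x hx y hy hxy h
  have hx' := mem_irreducibleFactors.1 hx
  have hy' := mem_irreducibleFactors.1 hy
  exact hxy (le_antisymm h (hx'.2 hy'.prop h))

/-- Every element is the join of the irreducible elements below it, and these joins can be computed
separately below each factor. -/
structure HasFactorization (L : Type*) [CompleteLattice L] [Finite L] : Prop where
  le_of_irreducible_le : ∀ X b : L, (∀ Y, IsIrreducibleElement Y → Y ≤ X → Y ≤ b) → X ≤ b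
  le_sSup_factor : ∀ X : L, ∀ k ∈ irreducibleFactors X, ∀ a : Finset L,
    (∀ y ∈ a, IsIrreducibleElement y) → sSup (a : Set L) = X →
      k ≤ sSup {y | y ∈ a ∧ y ≤ k}

/-- Nested sets with respect to a set `G` of elements of a lattice, not containing the maximum. -/
def IsNested [CompleteLattice L] (G : Set L) (s : Finset L) : Prop :=
  (∀ x ∈ s, x ∈ G ∧ x ≠ ⊤) ∧
    ∀ a ⊆ s, IsAntichain (· ≤ ·) (a : Set L) → (a : Set L).Nontrivial → sSup (a : Set L) ∉ G

variable [CompleteLattice L]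

theorem IsNested.mono {G : Set L} {s t : Finset L} (hs : IsNested G s) (h : t ⊆ s) :
    IsNested G t :=
  ⟨fun x hx => hs.1 x (h hx), fun a ha => hs.2 a (ha.trans h)⟩

/-- `G` is a set of elements containing the irreducible ones, for which `X` is a maximal element in
the complement of `G ∪ {⊥}`, and such that the elements of `G` that are not irreducible are closed
upwards. -/
structure IsBuildingStep (G : Set L) (X : L) : Prop where
  irreducible_mem : ∀ Y, IsIrreducibleElement Y → Y ∈ G
  mem_of_lt : ∀ Y ∈ G, ¬ IsIrreducibleElement Y → ∀ Z, Y < Z → Z ∈ G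
  notMem : X ∉ G
  ne_bot : X ≠ ⊥
  ne_top : X ≠ ⊤
  mem_of_gt : ∀ Z, X < Z → Z ∈ G

theorem IsBuildingStep.not_irreducible {G : Set L} {X : L} (h : IsBuildingStep G X) : ¬ IsIrreducibleElement X :=
  fun hX => h.notMem (h.irreducible_mem X hX)

/-- A reducible element of `G` below `X` would force `X ∈ G` by upward closure. This is why the
factors of `X` can be taken with respect to the irreducibles instead of `G`. -/
theorem IsBuildingStep.irreducible_of_le {G : Set L} {X : L} (h : IsBuildingStep G X) {Y : L} (hY : Y ∈ G) (hYX : Y ≤ X) :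
    IsIrreducibleElement Y := by
  by_contra hI
  rcases hYX.eq_or_lt with rfl | hlt
  · exact h.notMem hY
  · exact h.notMem (h.mem_of_lt Y hY hI X hlt)

variable [Finite L]

theorem HasFactorization.sSup_irreducibleFactors (hL : HasFactorization L) (X : L) :
    sSup (irreducibleFactors X : Set L) = X := by
  apply le_antisymm
  · exact sSup_le fun y hy => (mem_irreducibleFactors.1 hy).prop.2
  · refine hL.le_of_irreducible_le _ _ fun Y hY hYX => ?_
    obtain ⟨k, hk, hYk⟩ := exists_le_mem_irreducibleFactors hY hYX
    exact hYk.trans (le_sSup hk)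

/-- `X` is the join of its factors, so no factor would give `⊥` and a single one would make `X`
irreducible. -/
theorem HasFactorization.nontrivial_irreducibleFactors (hL : HasFactorization L) {X : L}
    (hX : X ≠ ⊥) (hI : ¬ IsIrreducibleElement X) : (irreducibleFactors X : Set L).Nontrivial := by
  have h := hL.sSup_irreducibleFactors X
  rcases (irreducibleFactors X : Set L).eq_empty_or_nonempty with h0 | h0
  · rw [h0, sSup_empty] at h
    exact absurd h.symm hX
  · by_contra hn
    rw [Set.not_nontrivial_iff] at hn
    obtain ⟨y, hy⟩ := h0
    rw [hn.eq_singleton_of_mem hy, sSup_singleton] at h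
    exact hI (h ▸ (mem_irreducibleFactors.1 hy).prop.1)

namespace IsBuildingStep

variable {G : Set L} {X : L}

theorem factor_mem (h : IsBuildingStep G X) {k : L} (hk : k ∈ irreducibleFactors X) : k ∈ G :=
  h.irreducible_mem k (mem_irreducibleFactors.1 hk).prop.1

theorem factor_lt (h : IsBuildingStep G X) {k : L} (hk : k ∈ irreducibleFactors X) : k < X :=
  lt_of_le_of_ne (mem_irreducibleFactors.1 hk).prop.2
    fun hkX => h.notMem (hkX ▸ h.factor_mem hk)

theorem exists_factor_ge (h : IsBuildingStep G X) {Y : L} (hY : Y ∈ G) (hYX : Y ≤ X) :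
    ∃ k ∈ irreducibleFactors X, Y ≤ k :=
  exists_le_mem_irreducibleFactors (h.irreducible_of_le hY hYX) hYX

/-- By factorization the members of `a` below a factor `k` have join `k`. They form an antichain in
a nested set and `k ∈ G`, so there is only one of them, namely `k` itself. -/
theorem factors_subset (h : IsBuildingStep G X) (hL : HasFactorization L) {a : Finset L}
    (ha : IsNested G a) (hanti : IsAntichain (· ≤ ·) (a : Set L)) (hsup : sSup (a : Set L) = X) :
    irreducibleFactors X ⊆ a := by
  classical
  intro k hk
  have hirr : ∀ y ∈ a, IsIrreducibleElement y := fun y hy =>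
    h.irreducible_of_le (ha.1 y hy).1 (hsup ▸ le_sSup (Finset.mem_coe.2 hy))
  have hle := hL.le_sSup_factor X k hk a hirr hsup
  have hset : {y | y ∈ a ∧ y ≤ k} = ((a.filter (· ≤ k) : Finset L) : Set L) := by
    ext y; simp
  rw [hset] at hle
  have heq : sSup ((a.filter (· ≤ k) : Finset L) : Set L) = k :=
    le_antisymm (sSup_le fun y hy => (Finset.mem_filter.1 hy).2) hle
  have hsub : a.filter (· ≤ k) ⊆ a := Finset.filter_subset _ _
  have hnt : ¬ ((a.filter (· ≤ k) : Finset L) : Set L).Nontrivial := fun hnt =>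
    ha.2 _ hsub (hanti.subset (Finset.coe_subset.2 hsub)) hnt (by rw [heq]; exact h.factor_mem hk)
  rw [Set.not_nontrivial_iff] at hnt
  rcases ((a.filter (· ≤ k) : Finset L) : Set L).eq_empty_or_nonempty with h0 | ⟨y, hy⟩
  · rw [h0, sSup_empty] at heq
    exact absurd heq.symm (mem_irreducibleFactors.1 hk).prop.1.1
  · rw [hnt.eq_singleton_of_mem hy, sSup_singleton] at heq
    exact heq ▸ hsub (Finset.mem_coe.1 hy)

/-- If a set of factors has its join in `G`, this join is irreducible and hence below a single
factor `k`; distinct factors are incomparable, so every member of the set is `k`. -/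
theorem factors_nested (h : IsBuildingStep G X) : IsNested G (irreducibleFactors X) := by
  refine ⟨fun k hk => ⟨h.factor_mem hk, ((h.factor_lt hk).trans_le le_top).ne⟩, ?_⟩
  intro a ha _ hnt hG
  have hle : sSup (a : Set L) ≤ X :=
    sSup_le fun y hy => (h.factor_lt (ha (Finset.mem_coe.1 hy))).le
  obtain ⟨k, hk, hak⟩ := h.exists_factor_ge hG hle
  obtain ⟨x, hx, y, hy, hxy⟩ := hnt
  have key : ∀ z ∈ (a : Set L), z = k := fun z hz =>
    (isAntichain_irreducibleFactors X).eq (ha hz) hk ((le_sSup hz).trans hak)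
  exact hxy ((key x hx).trans (key y hy).symm)

/-- The only new restriction concerns antichains with join `X`, and by `factors_subset` these
contain all factors of `X`. -/
theorem insert_of_notMem (h : IsBuildingStep G X) (hL : HasFactorization L) {s : Finset L}
    (hXs : X ∉ s) :
    IsNested (insert X G) s ↔ IsNested G s ∧ ¬ irreducibleFactors X ⊆ s := by
  constructor
  · intro hs
    refine ⟨⟨fun x hx => ⟨((hs.1 x hx).1).resolve_left fun he => hXs (he ▸ hx), (hs.1 x hx).2⟩,
      fun a ha h1 h2 h3 => hs.2 a ha h1 h2 (Or.inr h3)⟩, fun hF => ?_⟩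
    exact hs.2 _ hF (isAntichain_irreducibleFactors X)
      (hL.nontrivial_irreducibleFactors h.ne_bot h.not_irreducible)
      (Or.inl (hL.sSup_irreducibleFactors X))
  · rintro ⟨hs, hF⟩
    refine ⟨fun x hx => ⟨Or.inr (hs.1 x hx).1, (hs.1 x hx).2⟩, ?_⟩
    rintro a ha h1 h2 (h3 | h3)
    · exact hF ((h.factors_subset hL (hs.mono ha) h1 h3).trans ha)
    · exact hs.2 a ha h1 h2 h3

open Classical in
-- This is the star of the new vertex. It works because `X` and the set of its factors have the same
-- join and can be exchanged in antichains.
theorem insert_insert_iff (h : IsBuildingStep G X) (hL : HasFactorization L) {τ : Finset L}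
    (hXτ : X ∉ τ) :
    IsNested (insert X G) (insert X τ) ↔
      IsNested G (τ ∪ irreducibleFactors X) ∧ ¬ irreducibleFactors X ⊆ τ := by
  have hFnt := hL.nontrivial_irreducibleFactors h.ne_bot h.not_irreducible
  have hFsup := hL.sSup_irreducibleFactors X
  have hFanti := isAntichain_irreducibleFactors X
  constructor
  · intro hs
    have hFτ : ¬ irreducibleFactors X ⊆ τ := fun hF =>
      hs.2 _ (hF.trans (Finset.subset_insert _ _)) hFanti hFnt (Or.inl hFsup)
    have hτG : ∀ y ∈ τ, y ∈ G ∧ y ≠ ⊤ := fun y hy =>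
      ⟨(hs.1 y (Finset.mem_insert_of_mem hy)).1.resolve_left fun he => hXτ (he ▸ hy),
        (hs.1 y (Finset.mem_insert_of_mem hy)).2⟩
    -- If `y` and `X` were incomparable, their join would lie strictly above `X`, hence in `G`.
    have hcomp : ∀ y ∈ τ, y ≤ X ∨ X ≤ y := by
      intro y hy
      by_contra! hn
      have hne : X ≠ y := fun he => hXτ (he ▸ hy)
      refine hs.2 {X, y} ?_ ?_ ?_ ?_
      · exact Finset.insert_subset_insert _ (Finset.singleton_subset_iff.2 hy)
      · rw [Finset.coe_pair]
        exact IsAntichain.insert (Set.subsingleton_singleton.isAntichain _) (by simpa using fun _ => hn.1)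
          (by simpa using fun _ => hn.2)
      · rw [Finset.coe_pair]
        exact Set.nontrivial_pair hne
      · rw [Finset.coe_pair, sSup_pair]
        refine Or.inr (h.mem_of_gt _ (lt_of_le_of_ne le_sup_left fun he => hn.1 ?_))
        exact he ▸ le_sup_right
    refine ⟨⟨?_, ?_⟩, hFτ⟩
    · intro x hx
      rcases Finset.mem_union.1 hx with hx | hx
      · exact hτG x hx
      · exact h.factors_nested.1 x hx
    · intro a ha hanti hnt hG
      by_cases haτ : a ⊆ τ
      · exact hs.2 a (haτ.trans (Finset.subset_insert _ _)) hanti hnt (Or.inr hG)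
      · obtain ⟨k, hka, hkτ⟩ := Finset.not_subset.1 haτ
        have hkF : k ∈ irreducibleFactors X := (Finset.mem_union.1 (ha hka)).resolve_left hkτ
        -- A member of `a` above `X` would be above the factor `k ∈ a`, which the antichain forbids.
        -- Hence `a` lies below `X`, and its join lies below one factor.
        have hle : sSup (a : Set L) ≤ X := by
          refine sSup_le fun y hy => ?_
          rcases Finset.mem_union.1 (ha (Finset.mem_coe.1 hy)) with hyτ | hyF
          · refine (hcomp y hyτ).resolve_right fun hXy => ?_
            have hky : k < y := (h.factor_lt hkF).trans_le hXy
            exact hky.ne (hanti.eq hka hy hky.le)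
          · exact (h.factor_lt hyF).le
        obtain ⟨j, hj, haj⟩ := h.exists_factor_ge hG hle
        have hkj : k = j := hFanti.eq hkF hj ((le_sSup (Finset.mem_coe.2 hka)).trans haj)
        obtain ⟨y, hy, hyk⟩ := hnt.exists_ne k
        exact hyk (hanti.eq hy hka (hkj ▸ (le_sSup hy).trans haj))
  · rintro ⟨hs, hFτ⟩
    have hτ := hs.mono (Finset.subset_union_left (s₁ := τ) (s₂ := irreducibleFactors X))
    refine ⟨?_, ?_⟩
    · intro x hx
      rcases Finset.mem_insert.1 hx with rfl | hx
      · exact ⟨Or.inl rfl, h.ne_top⟩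
      · exact ⟨Or.inr (hτ.1 x hx).1, (hτ.1 x hx).2⟩
    · intro a ha hanti hnt hG
      by_cases hXa : X ∈ a
      · have hlt : X < sSup (a : Set L) := by
          obtain ⟨y, hy, hyX⟩ := hnt.exists_ne X
          refine lt_of_le_of_ne (le_sSup (Finset.mem_coe.2 hXa)) fun he => hyX ?_
          exact hanti.eq hy hXa (he ▸ le_sSup hy)
        have hZ := h.mem_of_gt _ hlt
        -- Replace `X` by its factors and keep the maximal elements: the join is unchanged, and `b`
        -- is an antichain to which nestedness for `G` applies.
        obtain ⟨b, hb, hbanti, hbsup, hbge⟩ :=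
          exists_antichain_same_sSup (a.erase X ∪ irreducibleFactors X)
        have hsup : sSup (b : Set L) = sSup (a : Set L) := by
          rw [hbsup, Finset.coe_union, sSup_union, hFsup, sup_comm, ← sSup_insert,
            ← Finset.coe_insert, Finset.insert_erase hXa]
        have hbs : b ⊆ τ ∪ irreducibleFactors X := by
          refine hb.trans (Finset.union_subset_union_left fun x hx => ?_)
          have hx' := Finset.mem_erase.1 hx
          exact (Finset.mem_insert.1 (ha hx'.2)).resolve_left hx'.1
        -- A single element `z` of `b` would dominate all factors, hence `X`; but members of `a`
        -- other than `X` are incomparable to `X`, and factors are strictly below it.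
        have hbnt : (b : Set L).Nontrivial := by
          by_contra hn
          rw [Set.not_nontrivial_iff] at hn
          obtain ⟨k, hk⟩ := hFnt.nonempty
          obtain ⟨z, hz, -⟩ := hbge k (Finset.mem_union_right _ hk)
          have hXz : X ≤ z := by
            rw [← hFsup]
            refine sSup_le fun j hj => ?_
            obtain ⟨w, hw, hjw⟩ := hbge j (Finset.mem_union_right _ hj)
            exact hjw.trans (hn hw hz).le
          rcases Finset.mem_union.1 (hb hz) with hz' | hz'
          · have hz'' := Finset.mem_erase.1 hz'
            exact hz''.1 (hanti.eq hXa hz''.2 hXz).symm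
          · exact absurd (h.factor_lt hz') (not_lt_of_ge hXz)
        exact hs.2 b hbs hbanti hbnt (hsup ▸ hZ)
      · have haτ : a ⊆ τ := fun x hx =>
          (Finset.mem_insert.1 (ha hx)).resolve_left fun he => hXa (he ▸ hx)
        rcases hG with hG | hG
        · exact hFτ ((h.factors_subset hL (hτ.mono haτ) hanti hG).trans haτ)
        · exact hτ.2 a haτ hanti hnt hG

theorem stellar_faces (h : IsBuildingStep G X) (hL : HasFactorization L)
    {K : PreAbstractSimplicialComplex L} (hK : ∀ s, s ∈ K.faces ↔ s.Nonempty ∧ IsNested G s)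
    (s : Finset L) :
    s ∈ (K.stellar (irreducibleFactors X) X).faces ↔ s.Nonempty ∧ IsNested (insert X G) s := by
  classical
  have hFne : (irreducibleFactors X).Nonempty :=
    (hL.nontrivial_irreducibleFactors h.ne_bot h.not_irreducible).nonempty
  constructor
  · rintro (⟨hs, hF⟩ | ⟨τ, hF, hτ, rfl⟩)
    · have hs' := (hK s).1 hs
      exact ⟨hs'.1, (h.insert_of_notMem hL fun hX => h.notMem (hs'.2.1 X hX).1).2 ⟨hs'.2, hF⟩⟩
    · have hτ' := ((hK _).1 hτ).2
      have hτ'' : IsNested G (τ ∪ irreducibleFactors X) := by convert hτ'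
      refine ⟨Finset.insert_nonempty _ _, ?_⟩
      convert (h.insert_insert_iff hL fun hX =>
        h.notMem (hτ''.1 X (Finset.mem_union_left _ hX)).1).2 ⟨hτ'', hF⟩
  · rintro ⟨hne, hs⟩
    by_cases hX : X ∈ s
    · have h2 := (h.insert_insert_iff hL (Finset.notMem_erase X s)).1
        (by rwa [Finset.insert_erase hX])
      refine Or.inr ⟨s.erase X, h2.2, ?_, ?_⟩
      · rw [hK]
        refine ⟨hFne.mono ?_, ?_⟩
        · convert Finset.subset_union_right
        · convert h2.1
      · convert (Finset.insert_erase hX).symm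
    · have h2 := (h.insert_of_notMem hL hX).1 hs
      exact Or.inl ⟨(hK s).2 ⟨hne, h2.1⟩, h2.2⟩

end IsBuildingStep

end Nested

section StellarSequence

variable {L : Type*} [CompleteLattice L] [Finite L]

/-- Induction on the list of elements still missing from `G`. The invariant is that the faces of `K`
are the nonempty nested sets of `G`, and that the reducible part of `G` is closed upwards. -/
theorem isStellarSequence_orderComplex (hL : HasFactorization L)
    (htop : IsIrreducibleElement (⊤ : L)) (l : List L) :
    ∀ (G : Set L) (K : PreAbstractSimplicialComplex L),
      (∀ Y, IsIrreducibleElement Y → Y ∈ G) →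
      (∀ Y ∈ G, ¬ IsIrreducibleElement Y → ∀ Z, Y < Z → Z ∈ G) → ⊥ ∉ G →
      (∀ s, s ∈ K.faces ↔ s.Nonempty ∧ IsNested G s) → l.Nodup →
      (∀ X, X ∈ l ↔ X ≠ ⊥ ∧ X ∉ G) → l.Pairwise (fun X Y => ¬ X < Y) →
      IsStellarSequence K (l.map fun X => (irreducibleFactors X, X)) (orderComplex L) := by
  classical
  induction l with
  | nil =>
    intro G K _ _ hbot hK _ hl _
    have hG : ∀ X : L, X ∈ G ↔ X ≠ ⊥ := by
      intro X
      refine ⟨fun h he => hbot (he ▸ h), fun h => ?_⟩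
      by_contra hX
      simpa using (hl X).2 ⟨h, hX⟩
    have hKo : K = orderComplex L := by
      refine PreAbstractSimplicialComplex.ext (Set.ext fun s => ?_)
      rw [hK]
      constructor
      · rintro ⟨hne, hs⟩
        refine ⟨hne, fun h => hbot (hs.1 _ h).1, fun h => (hs.1 _ h).2 rfl, ?_⟩
        intro x hx y hy hxy
        -- The join of two incomparable elements is not `⊥`, so it lies in the final `G`.
        by_contra! hn
        refine hs.2 {x, y} ?_ ?_ ?_ ?_
        · exact Finset.insert_subset hx (Finset.singleton_subset_iff.2 hy)
        · rw [Finset.coe_pair]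
          exact IsAntichain.insert (Set.subsingleton_singleton.isAntichain _)
            (by simpa using fun _ => hn.2) (by simpa using fun _ => hn.1)
        · rw [Finset.coe_pair]
          exact Set.nontrivial_pair hxy
        · rw [Finset.coe_pair, sSup_pair, hG]
          intro h
          exact (hG x).1 (hs.1 x hx).1 (le_bot_iff.1 (h ▸ le_sup_left))
      · rintro ⟨hne, hb, ht, hc⟩
        refine ⟨hne, fun x hx => ⟨(hG x).2 fun h => hb (h ▸ hx), fun h => ht (h ▸ hx)⟩, ?_⟩
        rintro a ha hanti ⟨x, hx, y, hy, hxy⟩ -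
        rcases hc (ha hx) (ha hy) hxy with h | h
        · exact hanti hx hy hxy h
        · exact hanti hy hx hxy.symm h
    rw [hKo]
    exact IsStellarSequence.nil _
  | cons X l ih =>
    intro G K hI hup hbot hK hnd hl hp
    have hX := (hl X).1 List.mem_cons_self
    have hnd' := List.nodup_cons.1 hnd
    have hp' := List.pairwise_cons.1 hp
    have h : IsBuildingStep G X :=
      { irreducible_mem := hI
        mem_of_lt := hup
        notMem := hX.2
        ne_bot := hX.1
        ne_top := fun he => hX.2 (hI X (he ▸ htop))
        -- An element above `X` missing from `G` would come later in the list, against its order.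
        mem_of_gt := by
          intro Z hZ
          by_contra hZG
          have hZl := (hl Z).2 ⟨(bot_le.trans_lt hZ).ne', hZG⟩
          rcases List.mem_cons.1 hZl with rfl | hZl
          · exact lt_irrefl _ hZ
          · exact hp'.1 Z hZl hZ }
    refine IsStellarSequence.cons _ _ _ _ _ ?_ ?_ ?_
    · exact (hK _).2 ⟨(hL.nontrivial_irreducibleFactors h.ne_bot h.not_irreducible).nonempty,
        h.factors_nested⟩
    · intro hXK
      exact h.notMem (((hK _).1 hXK).2.1 X (Finset.mem_singleton_self X)).1
    · refine ih (insert X G) _ (fun Y hY => Or.inr (hI Y hY)) ?_ ?_ (h.stellar_faces hL hK)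
        hnd'.2 ?_ hp'.2
      · rintro Y (rfl | hY) hYI Z hYZ
        · exact Or.inr (h.mem_of_gt Z hYZ)
        · exact Or.inr (hup Y hY hYI Z hYZ)
      · rintro (he | he)
        · exact h.ne_bot he.symm
        · exact hbot he
      · intro Y
        constructor
        · intro hY
          have hY' := (hl Y).1 (List.mem_cons_of_mem _ hY)
          refine ⟨hY'.1, ?_⟩
          rintro (rfl | hYG)
          · exact hnd'.1 hY
          · exact hY'.2 hYG
        · rintro ⟨hYb, hYG⟩
          refine (List.mem_cons.1 ((hl Y).2 ⟨hYb, fun he => hYG (Or.inr he)⟩)).resolve_left ?_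
          exact fun he => hYG (Or.inl he)

omit [CompleteLattice L] [Finite L] in
theorem exists_list_pairwise_not_lt [PartialOrder L] (s : Finset L) :
    ∃ l : List L, l.Nodup ∧ (∀ X, X ∈ l ↔ X ∈ s) ∧ l.Pairwise (fun X Y => ¬ X < Y) := by
  classical
  induction s using Finset.strongInduction with
  | H s ih =>
    rcases s.eq_empty_or_nonempty with rfl | hs
    · exact ⟨[], by simp⟩
    · obtain ⟨m, hm⟩ := s.exists_maximal hs
      obtain ⟨l, hnd, hl, hp⟩ := ih (s.erase m) (Finset.erase_ssubset hm.prop)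
      refine ⟨m :: l, ?_, ?_, ?_⟩
      · rw [List.nodup_cons]
        exact ⟨fun h => Finset.notMem_erase m s ((hl m).1 h), hnd⟩
      · intro X
        rw [List.mem_cons, hl, Finset.mem_erase]
        constructor
        · rintro (rfl | h)
          · exact hm.prop
          · exact h.2
        · intro h
          by_cases hX : X = m
          · exact Or.inl hX
          · exact Or.inr ⟨hX, h⟩
      · rw [List.pairwise_cons]
        exact ⟨fun Y hY => hm.not_gt (Finset.mem_of_mem_erase ((hl Y).1 hY)), hp⟩

omit [CompleteLattice L] in
theorem exists_isOppositeLinearExtension [PartialOrder L] [OrderBot L] :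
    ∃ l : List L, IsOppositeLinearExtension l := by
  obtain ⟨l, hnd, hl, hp⟩ := exists_list_pairwise_not_lt
    (Set.toFinite {X : L | X ≠ ⊥ ∧ ¬ IsIrreducibleElement X}).toFinset
  exact ⟨l, hnd, fun X => by simp [hl], hp⟩

end StellarSequence

/-! ### Irreducible partitions, factorization, and laminar families of blocks -/

section BlockPartition

variable {n : ℕ}

theorem blockPartition_le_iff {A : Set (Fin n)} {X : PartitionLattice n} :
    blockPartition A ≤ X ↔ ∀ i ∈ A, ∀ j ∈ A, X i j := by
  constructor
  · intro h i hi j hj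
    exact h (Or.inr ⟨hi, hj⟩)
  · rintro h i j (rfl | ⟨hi, hj⟩)
    · exact X.refl' _
    · exact h i hi j hj

theorem blockPartition_le_blockPartition {A B : Set (Fin n)} (hA : A.Nontrivial) :
    blockPartition A ≤ blockPartition B ↔ A ⊆ B := by
  rw [blockPartition_le_iff]
  constructor
  · intro h i hi
    obtain ⟨j, hj, hji⟩ := hA.exists_ne i
    rcases h i hi j hj with he | he
    · exact absurd he.symm hji
    · exact he.1
  · exact fun h i hi j hj => Or.inr ⟨h hi, h hj⟩

theorem blockPartition_injOn : Set.InjOn (blockPartition (n := n)) {A | A.Nontrivial} :=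
  fun _ hA _ hB h => Set.Subset.antisymm ((blockPartition_le_blockPartition hA).1 h.le)
    ((blockPartition_le_blockPartition hB).1 h.ge)

theorem blockPartition_ne_bot {A : Set (Fin n)} (hA : A.Nontrivial) : blockPartition A ≠ ⊥ := by
  obtain ⟨i, hi, j, hj, hij⟩ := hA
  intro h
  have : (⊥ : PartitionLattice n) i j := h ▸ Or.inr ⟨hi, hj⟩
  exact hij this

theorem blockPartition_univ : blockPartition (Set.univ : Set (Fin n)) = ⊤ := by
  refine top_le_iff.1 fun i j _ => Or.inr ⟨trivial, trivial⟩

/-- The analogue of the fact that a group is not the union of two proper subgroups. From a pair `i,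
j` outside `E` and a pair `k, l` outside `F`, transitivity puts both `j, k` and `j, l` into `F`,
hence also `k, l`. -/
theorem Setoid.total_on_or_total_on {α : Type*} {E F : Setoid α} {A : Set α}
    (h : ∀ i ∈ A, ∀ j ∈ A, E i j ∨ F i j) :
    (∀ i ∈ A, ∀ j ∈ A, E i j) ∨ (∀ i ∈ A, ∀ j ∈ A, F i j) := by
  by_contra! hn
  obtain ⟨⟨i, hi, j, hj, hij⟩, ⟨k, hk, l, hl, hkl⟩⟩ := hn
  have hF := (h i hi j hj).resolve_left hij
  have hE := (h k hk l hl).resolve_right hkl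
  have hik : E i k := by
    refine (h i hi k hk).elim id fun hik => ?_
    refine E.trans' ((h i hi l hl).resolve_right fun hil => ?_) (E.symm' hE)
    exact hkl (F.trans' (F.symm' hik) hil)
  have hjk : F j k := (h j hj k hk).resolve_left fun hjk => hij (E.trans' hik (E.symm' hjk))
  have hjl : F j l := (h j hj l hl).resolve_left fun hjl =>
    hij (E.trans' hik (E.trans' hE (E.symm' hjl)))
  exact hkl (F.trans' (F.symm' hjk) hjl)

/-- In a product decomposition, the two coordinate axes have tops that are partitions `E` and `F`
below `blockPartition A`. Every pair in `A` gives an atom, and an atom of a product lies on one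
axis, so `E` and `F` together relate all pairs in `A`. One of them then does so alone, and the other
factor of the product is trivial. -/
theorem isIrreducibleElement_blockPartition {A : Set (Fin n)} (hA : A.Nontrivial) :
    IsIrreducibleElement (blockPartition A) := by
  refine ⟨blockPartition_ne_bot hA, fun P Q _ _ _ _ => ⟨fun e => ?_⟩⟩
  -- `P` and `Q` are mere partial orders; the extreme elements of their product come from the ends
  -- of the interval.
  obtain ⟨b, hb⟩ : ∃ b : P × Q, ∀ z, b ≤ z :=
    ⟨e ⟨⊥, le_rfl, bot_le⟩, fun z => by
      rw [← e.le_symm_apply]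
      exact (e.symm z).2.1⟩
  obtain ⟨t, ht⟩ : ∃ t : P × Q, ∀ z, z ≤ t :=
    ⟨e ⟨blockPartition A, bot_le, le_rfl⟩, fun z => by
      rw [← e.symm_apply_le]
      exact (e.symm z).2.2⟩
  have hcases : ∀ i ∈ A, ∀ j ∈ A, (e.symm (t.1, b.2)).1 i j ∨ (e.symm (b.1, t.2)).1 i j := by
    intro i hi j hj
    by_cases hij : i = j
    · exact Or.inl (hij ▸ Setoid.refl' _ _)
    let z : Set.Icc (⊥ : PartitionLattice n) (blockPartition A) :=
      ⟨blockPartition {i, j}, bot_le, by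
        rw [blockPartition_le_iff]
        rintro k (rfl | rfl) m (rfl | rfl) <;> exact Or.inr ⟨by assumption, by assumption⟩⟩
    have hz : ∀ w : Set.Icc (⊥ : PartitionLattice n) (blockPartition A), w ≤ z →
        w = e.symm b ∨ w.1 i j := by
      intro w hw
      by_cases hij : w.1 i j
      · exact Or.inr hij
      · refine Or.inl (le_antisymm ?_ ?_)
        · intro k m hkm
          rcases hw hkm with rfl | ⟨hk, hm⟩
          · exact (e.symm b).1.refl' _
          · rcases hk with rfl | rfl <;> rcases hm with rfl | rfl
            · exact (e.symm b).1.refl' _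
            · exact absurd hkm hij
            · exact absurd (w.1.symm' hkm) hij
            · exact (e.symm b).1.refl' _
        · rw [e.symm_apply_le]
          exact hb _
    have h1 : e.symm ((e z).1, b.2) ≤ z := by
      rw [e.symm_apply_le]
      exact ⟨le_rfl, (hb _).2⟩
    have h2 : e.symm (b.1, (e z).2) ≤ z := by
      rw [e.symm_apply_le]
      exact ⟨(hb (_, (e z).2)).1, le_rfl⟩
    have h1' : e.symm ((e z).1, b.2) ≤ e.symm (t.1, b.2) :=
      e.symm.monotone ⟨(ht (e z)).1, le_rfl⟩
    have h2' : e.symm (b.1, (e z).2) ≤ e.symm (b.1, t.2) :=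
      e.symm.monotone ⟨le_rfl, (ht (e z)).2⟩
    rcases hz _ h1 with h | h
    · rcases hz _ h2 with h' | h'
      · exfalso
        have g1 := congrArg Prod.fst (e.symm.injective h)
        have g2 := congrArg Prod.snd (e.symm.injective h')
        have hzb : z = e.symm b := by
          rw [← e.symm_apply_apply z]
          exact congrArg _ (Prod.ext g1 g2)
        have hz0 : z ≤ ⟨⊥, le_rfl, bot_le⟩ := by
          rw [hzb, e.symm_apply_le]
          exact hb _
        exact hij (hz0 (Or.inr ⟨Or.inl rfl, Or.inr rfl⟩))
      · exact Or.inr (h2' h')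
    · exact Or.inl (h1' h)
  have htop : ∀ c : P × Q, (∀ i ∈ A, ∀ j ∈ A, (e.symm c).1 i j) → c = t := by
    intro c hc
    refine le_antisymm (ht c) ?_
    rw [← e.symm.le_iff_le]
    exact (e.symm t).2.2.trans (blockPartition_le_iff.2 hc)
  rcases Setoid.total_on_or_total_on hcases with h | h
  · have hbt : b.2 = t.2 := (Prod.ext_iff.1 (htop (t.1, b.2) h)).2
    obtain ⟨x, y, hxy⟩ := exists_pair_ne Q
    have hx : ∀ x : Q, x = b.2 := fun x => le_antisymm (hbt ▸ (ht (b.1, x)).2) (hb (b.1, x)).2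
    exact hxy ((hx x).trans (hx y).symm)
  · have hbt : b.1 = t.1 := (Prod.ext_iff.1 (htop (b.1, t.2) h)).1
    obtain ⟨x, y, hxy⟩ := exists_pair_ne P
    have hx : ∀ x : P, x = b.1 := fun x => le_antisymm (hbt ▸ (ht (x, b.2)).1) (hb (x, b.2)).1
    exact hxy ((hx x).trans (hx y).symm)

/-- The partition obtained from `X` by splitting all blocks that meet `A` into singletons. -/
@[reducible]
def splitPartition (X : PartitionLattice n) (A : Set (Fin n))
    (hA : ∀ i j, X i j → i ∈ A → j ∈ A) : PartitionLattice n where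
  r i j := i = j ∨ (X i j ∧ i ∉ A)
  iseqv :=
    { refl := fun _ => Or.inl rfl
      symm := by
        rintro i j (rfl | ⟨h, hi⟩)
        · exact Or.inl rfl
        · exact Or.inr ⟨X.symm' h, fun hj => hi (hA _ _ (X.symm' h) hj)⟩
      trans := by
        rintro i j k (rfl | ⟨h, hi⟩) (rfl | ⟨h', hj⟩)
        · exact Or.inl rfl
        · exact Or.inr ⟨h', hj⟩
        · exact Or.inr ⟨h, hi⟩
        · exact Or.inr ⟨X.trans' h h', hi⟩ }

/-- If `X` has a further nontrivial block besides `A`, refining `X` means refining `A` and the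
remaining blocks independently, so the interval below `X` is a product. -/
theorem eq_blockPartition_of_isIrreducibleElement {X : PartitionLattice n}
    (hX : IsIrreducibleElement X) : ∃ A : Set (Fin n), A.Nontrivial ∧ X = blockPartition A := by
  obtain ⟨i, j, hij, hne⟩ : ∃ i j, X i j ∧ i ≠ j := by
    by_contra! h
    exact hX.1 (le_bot_iff.1 fun i j hij => h i j hij)
  set A : Set (Fin n) := {k | X i k} with hAdef
  have hA : ∀ k l, X k l → k ∈ A → l ∈ A := fun k l h hk => X.trans' hk h
  have hAX : blockPartition A ≤ X :=
    blockPartition_le_iff.2 fun k hk l hl => X.trans' (X.symm' hk) hl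
  have hAn : A.Nontrivial := ⟨i, X.refl' i, j, hij, hne⟩
  refine ⟨A, hAn, ?_⟩
  by_contra hXA
  have hPne : (⊥ : PartitionLattice n) ≠ blockPartition A := (blockPartition_ne_bot hAn).symm
  have hQX : splitPartition X A hA ≤ X := by
    rintro k l (rfl | h)
    · exact X.refl' _
    · exact h.1
  have hQne : (⊥ : PartitionLattice n) ≠ splitPartition X A hA := by
    intro hQ
    refine hXA (le_antisymm (fun k l hkl => ?_) hAX)
    by_cases hk : k ∈ A
    · exact Or.inr ⟨hk, hA _ _ hkl hk⟩
    · have : (⊥ : PartitionLattice n) k l := hQ ▸ Or.inr ⟨hkl, hk⟩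
      exact Or.inl this
  have : Nontrivial (Set.Icc (⊥ : PartitionLattice n) (blockPartition A)) :=
    ⟨⟨⊥, le_rfl, bot_le⟩, ⟨_, bot_le, le_rfl⟩, fun h => hPne (congrArg Subtype.val h)⟩
  have : Nontrivial (Set.Icc (⊥ : PartitionLattice n) (splitPartition X A hA)) :=
    ⟨⟨⊥, le_rfl, bot_le⟩, ⟨_, bot_le, le_rfl⟩, fun h => hQne (congrArg Subtype.val h)⟩
  refine (hX.2 (Set.Icc (⊥ : PartitionLattice n) (blockPartition A))
    (Set.Icc (⊥ : PartitionLattice n) (splitPartition X A hA))).false ?_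
  let f : Set.Icc (⊥ : PartitionLattice n) X ↪o
      Set.Icc (⊥ : PartitionLattice n) (blockPartition A) ×
      Set.Icc (⊥ : PartitionLattice n) (splitPartition X A hA) :=
    OrderEmbedding.ofMapLEIff (fun Z => (⟨Z.1 ⊓ blockPartition A, bot_le, inf_le_right⟩,
      ⟨Z.1 ⊓ splitPartition X A hA, bot_le, inf_le_right⟩)) (by
        intro Z W
        constructor
        · rintro ⟨h1, h2⟩ k l hkl
          by_cases hk : k ∈ A
          · exact (h1 ⟨hkl, Or.inr ⟨hk, hA _ _ (Z.2.2 hkl) hk⟩⟩).1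
          · exact (h2 ⟨hkl, Or.inr ⟨Z.2.2 hkl, hk⟩⟩).1
        · exact fun h => ⟨inf_le_inf_right (blockPartition A) h,
            inf_le_inf_right (splitPartition X A hA) h⟩)
  refine RelIso.ofSurjective f ?_
  rintro ⟨⟨P, hP0, hP⟩, ⟨Q, hQ0, hQ⟩⟩
  -- The plain union of the relations is already transitive: `P` is trivial outside `A`, `Q` is
  -- trivial inside `A`, and neither crosses between the two.
  let Z : PartitionLattice n :=
    { r := fun k l => P k l ∨ Q k l
      iseqv :=
        { refl := fun k => Or.inl (P.refl' k)
          symm := fun h => h.imp P.symm' Q.symm'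
          trans := by
            rintro k l m (h | h) (h' | h')
            · exact Or.inl (P.trans' h h')
            · rcases hP h with rfl | ⟨hk, hl⟩
              · exact Or.inr h'
              · rcases hQ h' with rfl | h''
                · exact Or.inl h
                · exact absurd hl h''.2
            · rcases hQ h with rfl | ⟨hkl, hk⟩
              · exact Or.inl h'
              · rcases hP h' with rfl | h''
                · exact Or.inr h
                · exact absurd (hA _ _ (X.symm' hkl) h''.1) hk
            · exact Or.inr (Q.trans' h h') } }
  have hZX : Z ≤ X := fun k l h => h.elim (fun h => hAX (hP h)) (fun h => hQX (hQ h))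
  refine ⟨⟨Z, bot_le, hZX⟩, Prod.ext (Subtype.ext ?_) (Subtype.ext ?_)⟩
  · apply le_antisymm
    · rintro k l ⟨h | h, h'⟩
      · exact h
      · rcases hQ h with rfl | h''
        · exact P.refl' _
        · rcases h' with rfl | h'
          · exact P.refl' _
          · exact absurd h'.1 h''.2
    · exact fun k l h => ⟨Or.inl h, hP h⟩
  · apply le_antisymm
    · rintro k l ⟨h | h, h'⟩
      · rcases hP h with rfl | h''
        · exact Q.refl' _
        · rcases h' with rfl | h'
          · exact Q.refl' _
          · exact absurd h''.1 h'.2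
      · exact h
    · exact fun k l h => ⟨Or.inr h, hQ h⟩

theorem isIrreducibleElement_iff {X : PartitionLattice n} :
    IsIrreducibleElement X ↔ ∃ A : Set (Fin n), A.Nontrivial ∧ X = blockPartition A :=
  ⟨eq_blockPartition_of_isIrreducibleElement, by
    rintro ⟨A, hA, rfl⟩
    exact isIrreducibleElement_blockPartition hA⟩

theorem hasFactorization_partitionLattice (n : ℕ) : HasFactorization (PartitionLattice n) where
  le_of_irreducible_le X b h := by
    intro i j hij
    by_cases hne : i = j
    · exact hne ▸ b.refl' i
    refine h (blockPartition {i, j})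
      (isIrreducibleElement_blockPartition (Set.nontrivial_pair hne)) ?_
      (Or.inr ⟨Or.inl rfl, Or.inr rfl⟩)
    rw [blockPartition_le_iff]
    rintro k (rfl | rfl) l (rfl | rfl)
    · exact X.refl' _
    · exact hij
    · exact X.symm' hij
    · exact X.refl' _
  le_sSup_factor X k hk a ha hX := by
    have hk' := mem_irreducibleFactors.1 hk
    obtain ⟨⟨hkI, hkX⟩, hmax⟩ := hk'
    obtain ⟨A, hA, rfl⟩ := isIrreducibleElement_iff.1 hkI
    -- Maximality of the factor makes `A` a full block of `X`.
    have hcl : ∀ i j, X i j → i ∈ A → j ∈ A := by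
      intro i j hij hi
      have hle : blockPartition A ≤ blockPartition {l | X i l} :=
        (blockPartition_le_blockPartition hA).2 fun l hl => blockPartition_le_iff.1 hkX i hi l hl
      have hle' := hmax ⟨isIrreducibleElement_blockPartition
        (hA.mono ((blockPartition_le_blockPartition hA).1 hle)),
        blockPartition_le_iff.2 fun l hl m hm => X.trans' (X.symm' hl) hm⟩ hle
      exact (blockPartition_le_blockPartition
        (hA.mono ((blockPartition_le_blockPartition hA).1 hle))).1 hle' hij
    set S : PartitionLattice n := sSup {y | y ∈ a ∧ y ≤ blockPartition A} with hS
    -- `X` refined by `S` inside `A`. It bounds every member of `a`, since a block meeting `A` lies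
    -- in `A`; hence `X ≤ Y`, and `S` relates all of `A`.
    let Y : PartitionLattice n :=
      { r := fun i j => X i j ∧ (i ∈ A → S i j)
        iseqv :=
          { refl := fun i => ⟨X.refl' i, fun _ => S.refl' i⟩
            symm := fun h => ⟨X.symm' h.1, fun hj => S.symm' (h.2 (hcl _ _ (X.symm' h.1) hj))⟩
            trans := fun h h' => ⟨X.trans' h.1 h'.1,
              fun hi => S.trans' (h.2 hi) (h'.2 (hcl _ _ h.1 hi))⟩ } }
    have hXY : X ≤ Y := by
      rw [← hX]
      refine sSup_le fun y hy => ?_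
      have hyX : y ≤ X := hX ▸ le_sSup hy
      obtain ⟨B, hB, rfl⟩ := isIrreducibleElement_iff.1 (ha y hy)
      intro i j hij
      refine ⟨hyX hij, fun hi => ?_⟩
      rcases hij with rfl | hij
      · exact S.refl' _
      · have hBA : B ⊆ A := fun l hl => hcl _ _ (blockPartition_le_iff.1 hyX i hij.1 l hl) hi
        have : blockPartition B ≤ S :=
          le_sSup ⟨hy, (blockPartition_le_blockPartition hB).2 hBA⟩
        exact this (Or.inr hij)
    rw [blockPartition_le_iff]
    intro i hi j hj
    exact (hXY (blockPartition_le_iff.1 hkX i hi j hj)).2 hi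

/-- Laminar sets of partitions with a single nontrivial block, different from the maximum. -/
def IsLaminar (s : Set (PartitionLattice n)) : Prop :=
  (∀ X ∈ s, ∃ A : Set (Fin n), A.Nontrivial ∧ A ≠ Set.univ ∧ X = blockPartition A) ∧
    ∀ A B : Set (Fin n), blockPartition A ∈ s → blockPartition B ∈ s →
      A.Nontrivial → B.Nontrivial → A ⊆ B ∨ B ⊆ A ∨ Disjoint A B

theorem blockPartition_eq_top_iff {A : Set (Fin n)} (hA : A.Nontrivial) :
    blockPartition A = ⊤ ↔ A = Set.univ := by
  constructor
  · intro h
    rw [← blockPartition_univ] at h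
    exact blockPartition_injOn hA (hA.mono (Set.subset_univ _)) h
  · rintro rfl
    exact blockPartition_univ

/-- Two overlapping blocks have as join the partition with block their union, which is irreducible;
so incomparable blocks of a nested set are disjoint. Conversely, a join of at least two pairwise
disjoint blocks keeps each of them separate. -/
theorem isNested_irreducible_iff (s : Finset (PartitionLattice n)) :
    IsNested {X | IsIrreducibleElement X} s ↔ IsLaminar (s : Set (PartitionLattice n)) := by
  classical
  constructor
  · intro hs
    refine ⟨fun X hX => ?_, fun A B hAs hBs hA hB => ?_⟩
    · obtain ⟨hXI, hXt⟩ := hs.1 X hX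
      obtain ⟨A, hA, rfl⟩ := isIrreducibleElement_iff.1 hXI
      exact ⟨A, hA, fun h => hXt ((blockPartition_eq_top_iff hA).2 h), rfl⟩
    · by_contra! hn
      obtain ⟨h1, h2, h3⟩ := hn
      obtain ⟨m, hmA, hmB⟩ := Set.not_disjoint_iff.1 h3
      refine hs.2 {blockPartition A, blockPartition B} ?_ ?_ ?_ ?_
      · exact Finset.insert_subset hAs (Finset.singleton_subset_iff.2 hBs)
      · rw [Finset.coe_pair]
        exact IsAntichain.insert (Set.subsingleton_singleton.isAntichain _)
          (by simpa [blockPartition_le_blockPartition hB] using fun _ => h2)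
          (by simpa [blockPartition_le_blockPartition hA] using fun _ => h1)
      · rw [Finset.coe_pair]
        refine Set.nontrivial_pair fun h => h1 ?_
        exact (blockPartition_le_blockPartition hA).1 h.le
      · rw [Finset.coe_pair, sSup_pair]
        have hsup : blockPartition A ⊔ blockPartition B = blockPartition (A ∪ B) := by
          apply le_antisymm
          · exact sup_le ((blockPartition_le_blockPartition hA).2 Set.subset_union_left)
              ((blockPartition_le_blockPartition hB).2 Set.subset_union_right)
          · have hm : ∀ i ∈ A ∪ B, (blockPartition A ⊔ blockPartition B) i m := by
              rintro i (hi | hi)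
              · exact (le_sup_left : blockPartition A ≤ _) (Or.inr ⟨hi, hmA⟩)
              · exact (le_sup_right : blockPartition B ≤ _) (Or.inr ⟨hi, hmB⟩)
            exact blockPartition_le_iff.2 fun i hi j hj =>
              Setoid.trans' _ (hm i hi) (Setoid.symm' _ (hm j hj))
        exact hsup ▸ isIrreducibleElement_blockPartition (hA.mono Set.subset_union_left)
  · rintro ⟨h1, h2⟩
    refine ⟨fun X hX => ?_, fun a ha hanti hnt hI => ?_⟩
    · obtain ⟨A, hA, hAu, rfl⟩ := h1 X hX
      exact ⟨isIrreducibleElement_blockPartition hA,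
        fun h => hAu ((blockPartition_eq_top_iff hA).1 h)⟩
    · obtain ⟨C, hC, hCe⟩ := isIrreducibleElement_iff.1 hI
      obtain ⟨x, hx, y, hy, hxy⟩ := hnt
      obtain ⟨A, hA, hAu, rfl⟩ := h1 x (ha hx)
      obtain ⟨B, hB, hBu, rfl⟩ := h1 y (ha hy)
      have hAC : A ⊆ C := (blockPartition_le_blockPartition hA).1 (hCe ▸ le_sSup hx)
      have hBC : B ⊆ C := (blockPartition_le_blockPartition hB).1 (hCe ▸ le_sSup hy)
      have hAB : Disjoint A B := by
        rcases h2 A B (ha hx) (ha hy) hA hB with h | h | h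
        · exact absurd ((blockPartition_le_blockPartition hA).2 h) (hanti hx hy hxy)
        · exact absurd ((blockPartition_le_blockPartition hB).2 h) (hanti hy hx hxy.symm)
        · exact h
      -- The partition into `A` and its complement bounds the join, whereas the block `C` of the
      -- join meets both parts.
      let Y : PartitionLattice n :=
        { r := fun i j => i ∈ A ↔ j ∈ A
          iseqv := ⟨fun _ => Iff.rfl, Iff.symm, Iff.trans⟩ }
      have hle : sSup (a : Set (PartitionLattice n)) ≤ Y := by
        refine sSup_le fun z hz => ?_
        obtain ⟨D, hD, -, rfl⟩ := h1 z (ha hz)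
        rw [blockPartition_le_iff]
        intro i hi j hj
        rcases h2 A D (ha hx) (ha hz) hA hD with h | h | h
        · have hAD : blockPartition A = blockPartition D :=
            hanti.eq hx hz ((blockPartition_le_blockPartition hA).2 h)
          rw [← blockPartition_injOn hA hD hAD] at hi hj
          exact iff_of_true hi hj
        · exact iff_of_true (h hi) (h hj)
        · exact iff_of_false (h.notMem_of_mem_right hi) (h.notMem_of_mem_right hj)
      obtain ⟨i, hi⟩ := hA.nonempty
      obtain ⟨j, hj⟩ := hB.nonempty
      rw [hCe] at hle
      exact hAB.notMem_of_mem_right hj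
        ((blockPartition_le_iff.1 hle i (hAC hi) j (hBC hj)).1 hi)

end BlockPartition

/-! ### Connected vertex sets in graphs and forests -/

section Preconnected

namespace SimpleGraph

variable {V W : Type*} {G : SimpleGraph V}

theorem Reachable.mem_of_adj_closed {S : Set V} (hS : ∀ v ∈ S, ∀ w, G.Adj v w → w ∈ S) {v w : V}
    (h : G.Reachable v w) (hv : v ∈ S) : w ∈ S := by
  obtain ⟨p⟩ := h
  induction p with
  | nil => exact hv
  | cons hadj _ ih => exact ih (hS _ hv _ hadj)

theorem preconnected_induce_of_forall_adj {S : Set V} {c : V} (hc : c ∈ S)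
    (h : ∀ x ∈ S, x = c ∨ G.Adj x c) : (G.induce S).Preconnected := by
  have key : ∀ x : S, (G.induce S).Reachable x ⟨c, hc⟩ := by
    rintro ⟨x, hx⟩
    rcases h x hx with rfl | hadj
    · exact Reachable.refl _
    · exact Adj.reachable (G := G.induce S) hadj
  exact fun x y => (key x).trans (key y).symm

/-- A walk in `S` lifts edge by edge, and the gaps between lifted edges are bridged inside the
fibres. -/
theorem preconnected_induce_preimage {H : SimpleGraph W} {f : V → W}
    (hfib : ∀ u, (G.induce (f ⁻¹' {u})).Preconnected)
    (hadj : ∀ a b, H.Adj a b → ∃ x y, f x = a ∧ f y = b ∧ G.Adj x y) {S : Set W}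
    (hS : (H.induce S).Preconnected) : (G.induce (f ⁻¹' S)).Preconnected := by
  have hfib' : ∀ x y : f ⁻¹' S, f x = f y → (G.induce (f ⁻¹' S)).Reachable x y := by
    rintro ⟨x, hx⟩ ⟨y, hy⟩ (hxy : f x = f y)
    have hle : f ⁻¹' {f y} ⊆ f ⁻¹' S := by
      intro z hz
      have : f z = f y := hz
      exact (this ▸ hy : f z ∈ S)
    exact ((hfib (f y)) ⟨x, hxy⟩ ⟨y, rfl⟩).map (induceHomOfLE G hle).toHom
  have key : ∀ (a b : S), (H.induce S).Reachable a b → ∀ x y : f ⁻¹' S, f x = a → f y = b →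
      (G.induce (f ⁻¹' S)).Reachable x y := by
    rintro a b ⟨p⟩
    induction p with
    | nil => exact fun x y hx hy => hfib' x y (hx.trans hy.symm)
    | @cons u v w huv q ih =>
      intro x y hx hy
      obtain ⟨x', y', hx', hy', hxy'⟩ := hadj _ _ huv
      have h1 : x' ∈ f ⁻¹' S := (hx' ▸ u.2 : f x' ∈ S)
      have h2 : y' ∈ f ⁻¹' S := (hy' ▸ v.2 : f y' ∈ S)
      refine (hfib' x ⟨x', h1⟩ (hx.trans hx'.symm)).trans ?_
      refine Reachable.trans ?_ (ih ⟨y', h2⟩ y hy' hy)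
      exact Adj.reachable (G := G.induce (f ⁻¹' S)) hxy'
  exact fun x y => key ⟨f x, x.2⟩ ⟨f y, y.2⟩ (hS _ _) x y rfl rfl

theorem subset_or_subset_compl_of_preconnected {S E : Set V} (hS : (G.induce S).Preconnected)
    (h : ∀ x ∈ S, ∀ y ∈ S, G.Adj x y → x ∈ E → y ∈ E) : S ⊆ E ∨ S ⊆ Eᶜ := by
  by_contra! hn
  obtain ⟨⟨x, hx, hxE⟩, ⟨y, hy, hyE⟩⟩ := And.imp Set.not_subset.1 Set.not_subset.1 hn
  have := Reachable.mem_of_adj_closed (G := G.induce S) (S := {z | z.1 ∈ E})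
    (fun v hv w hvw => h v v.2 w w.2 hvw hv) (hS ⟨y, hy⟩ ⟨x, hx⟩) (not_not.1 hyE)
  exact hxE this

/-- Every edge of a forest is a bridge. A second edge across the cut, together with paths inside the
two connected sides, would bypass the first. -/
theorem IsAcyclic.eq_of_adj_of_preconnected (hG : G.IsAcyclic) {E : Set V}
    (hE : (G.induce E).Preconnected) (hE' : (G.induce Eᶜ).Preconnected) {x y x' y' : V}
    (hx : x ∈ E) (hy : y ∉ E) (hx' : x' ∈ E) (hy' : y' ∉ E) (h : G.Adj x y) (h' : G.Adj x' y') :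
    x = x' ∧ y = y' := by
  by_contra hne
  have hb : ¬ (G.deleteEdges {s(x, y)}).Reachable x y :=
    isBridge_iff.1 (isAcyclic_iff_forall_adj_isBridge.1 hG h)
  refine hb ?_
  let g : G.induce E →g G.deleteEdges {s(x, y)} :=
    { toFun := Subtype.val
      map_rel' := by
        intro a b hab
        rw [deleteEdges_adj]
        refine ⟨hab, fun he => ?_⟩
        rcases Sym2.eq_iff.1 (Set.mem_singleton_iff.1 he) with ⟨-, h2⟩ | ⟨h1, -⟩
        · exact hy (h2 ▸ b.2)
        · exact hy (h1 ▸ a.2) }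
  let g' : G.induce Eᶜ →g G.deleteEdges {s(x, y)} :=
    { toFun := Subtype.val
      map_rel' := by
        intro a b hab
        rw [deleteEdges_adj]
        refine ⟨hab, fun he => ?_⟩
        rcases Sym2.eq_iff.1 (Set.mem_singleton_iff.1 he) with ⟨h1, -⟩ | ⟨-, h2⟩
        · exact a.2 (h1 ▸ hx)
        · exact b.2 (h2 ▸ hx) }
  have h1 : (G.deleteEdges {s(x, y)}).Reachable x x' := (hE ⟨x, hx⟩ ⟨x', hx'⟩).map g
  have h3 : (G.deleteEdges {s(x, y)}).Reachable y' y := (hE' ⟨y', hy'⟩ ⟨y, hy⟩).map g'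
  have h2 : (G.deleteEdges {s(x, y)}).Adj x' y' := by
    rw [deleteEdges_adj]
    refine ⟨h', fun he => ?_⟩
    rcases Sym2.eq_iff.1 (Set.mem_singleton_iff.1 he) with ⟨h1, h2⟩ | ⟨h1, -⟩
    · exact hne ⟨h1.symm, h2.symm⟩
    · exact hy (h1 ▸ hx')
  exact h1.trans (h2.reachable.trans h3)

/-- If no edge inside `D` crosses the cut of `E`, then `D` lies on one side of it; likewise for the
complement of `D`. Both cannot fail, as the cut of `E` has only one edge, whose end in `E` is not
both in `D` and outside. -/
theorem IsAcyclic.laminar_of_preconnected (hG : G.IsAcyclic) {D E : Set V} {r : V}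
    (hD : (G.induce D).Preconnected) (hD' : (G.induce Dᶜ).Preconnected)
    (hE : (G.induce E).Preconnected) (hE' : (G.induce Eᶜ).Preconnected)
    (hrD : r ∉ D) (hrE : r ∉ E) : D ⊆ E ∨ E ⊆ D ∨ Disjoint D E := by
  by_cases h1 : ∀ x ∈ D, ∀ y ∈ D, G.Adj x y → x ∈ E → y ∈ E
  · rcases subset_or_subset_compl_of_preconnected hD h1 with h | h
    · exact Or.inl h
    · exact Or.inr (Or.inr (Set.disjoint_left.2 h))
  by_cases h2 : ∀ x ∈ Dᶜ, ∀ y ∈ Dᶜ, G.Adj x y → x ∈ E → y ∈ E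
  · rcases subset_or_subset_compl_of_preconnected hD' h2 with h | h
    · exact absurd (h hrD) hrE
    · exact Or.inr (Or.inl (Set.compl_subset_compl.1 h))
  push Not at h1 h2
  obtain ⟨x, hx, y, -, hxy, hxE, hyE⟩ := h1
  obtain ⟨x', hx', y', -, hxy', hxE', hyE'⟩ := h2
  have := (hG.eq_of_adj_of_preconnected hE hE' hxE hyE hxE' hyE' hxy hxy').1
  exact absurd (this ▸ hx) hx'

end SimpleGraph

end Preconnected

/-! ### Trees with one internal edge and contractions onto them -/

namespace LabelledTree

section TwoLevel

variable {n : ℕ}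

theorem not_isLeaf_root (T : LabelledTree n) : ¬ T.IsLeaf T.root := by
  intro h
  have h1 := (T.degree_eq_one_iff T.root).2 h
  have h2 := T.two_le_degree_root
  omega

theorem exists_neighborSet_leaf (T : LabelledTree n) (i : Fin n) :
    ∃ w, T.graph.neighborSet (T.leaf i) = {w} :=
  Set.ncard_eq_one.1 ((T.degree_eq_one_iff _).2 ⟨i, rfl⟩)

theorem eq_of_adj_leaf (T : LabelledTree n) {i : Fin n} {v w : T.V}
    (hv : T.graph.Adj (T.leaf i) v) (hw : T.graph.Adj (T.leaf i) w) : v = w := by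
  obtain ⟨u, hu⟩ := T.exists_neighborSet_leaf i
  have h1 : v ∈ T.graph.neighborSet (T.leaf i) := hv
  have h2 : w ∈ T.graph.neighborSet (T.leaf i) := hw
  rw [hu] at h1 h2
  exact h1.trans h2.symm

theorem mem_of_adj_closed (T : LabelledTree n) {S : Set T.V}
    (hS : ∀ v ∈ S, ∀ w, T.graph.Adj v w → w ∈ S) {v : T.V} (hv : v ∈ S) (w : T.V) : w ∈ S :=
  (T.isTree.1.preconnected v w).mem_of_adj_closed hS hv

theorem not_adj_leaf_leaf (T : LabelledTree n) (i j : Fin n) :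
    ¬ T.graph.Adj (T.leaf i) (T.leaf j) := by
  intro h
  have := T.mem_of_adj_closed (S := {T.leaf i, T.leaf j}) (by
    rintro v (rfl | rfl) w hw
    · exact Or.inr (T.eq_of_adj_leaf hw h)
    · exact Or.inl (T.eq_of_adj_leaf hw h.symm)) (Or.inl rfl) T.root
  rcases this with h | h
  · exact T.not_isLeaf_root ⟨i, h.symm⟩
  · exact T.not_isLeaf_root ⟨j, h.symm⟩

/-- Otherwise `v` and its neighbouring leaves form a connected component and thus the whole tree. -/
theorem exists_adj_not_isLeaf (T : LabelledTree n) {v w : T.V} (hv : ¬ T.IsLeaf v)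
    (hw : ¬ T.IsLeaf w) (hwv : w ≠ v) : ∃ u, T.graph.Adj v u ∧ ¬ T.IsLeaf u := by
  by_contra! h
  have := T.mem_of_adj_closed (S := {x | x = v ∨ (T.IsLeaf x ∧ T.graph.Adj v x)}) (by
    rintro x (rfl | ⟨⟨i, rfl⟩, hx⟩) y hy
    · exact Or.inr ⟨h y hy, hy⟩
    · exact Or.inl (T.eq_of_adj_leaf hy hx.symm)) (Or.inl rfl) w
  rcases this with h | h
  · exact hwv h
  · exact hw h.1

/-- `T` has exactly one internal vertex `t`, and `t` is adjacent to the root. -/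
structure IsTwoLevel (T : LabelledTree n) (t : T.V) : Prop where
  isInternal : T.IsInternal t
  adj_root : T.graph.Adj T.root t
  eq_or_eq : ∀ v, ¬ T.IsLeaf v → v = T.root ∨ v = t

theorem exists_isTwoLevel (T : LabelledTree n) (h : T.internalEdges.ncard = 1) :
    ∃ t, T.IsTwoLevel t := by
  obtain ⟨e, he⟩ := Set.ncard_eq_one.1 h
  have hmem : ∀ x y, T.graph.Adj x y → ¬ T.IsLeaf x → ¬ T.IsLeaf y → s(x, y) = e := by
    intro x y hxy hx hy
    have : s(x, y) ∈ T.internalEdges := by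
      refine ⟨hxy, fun v hv => ?_⟩
      rcases Sym2.mem_iff.1 hv with rfl | rfl <;> assumption
    rw [he] at this
    exact this
  have hee : e ∈ T.internalEdges := he ▸ rfl
  obtain ⟨w, hw, hwr⟩ : ∃ w, ¬ T.IsLeaf w ∧ w ≠ T.root := by
    induction e using Sym2.ind with
    | _ a b =>
      have ha := hee.2 a (Sym2.mem_mk_left a b)
      have hb := hee.2 b (Sym2.mem_mk_right a b)
      by_cases har : a = T.root
      · refine ⟨b, hb, fun hbr => ?_⟩
        have hab : T.graph.Adj a b := hee.1
        exact hab.ne (har.trans hbr.symm)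
      · exact ⟨a, ha, har⟩
  obtain ⟨t, hrt, ht⟩ := T.exists_adj_not_isLeaf T.not_isLeaf_root hw hwr
  refine ⟨t, ⟨hrt.ne', ht⟩, hrt, fun v hv => ?_⟩
  by_cases hvr : v = T.root
  · exact Or.inl hvr
  · obtain ⟨u, hvu, hu⟩ := T.exists_adj_not_isLeaf hv T.not_isLeaf_root (Ne.symm hvr)
    have := (hmem v u hvu hv hu).trans (hmem _ _ hrt T.not_isLeaf_root ht).symm
    rcases Sym2.eq_iff.1 this with h | h
    · exact Or.inl h.1
    · exact Or.inr h.1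

theorem isTwoLevel_of_isInternal (T : LabelledTree n) (h : T.internalEdges.ncard = 1) {t : T.V}
    (ht : T.IsInternal t) : T.IsTwoLevel t := by
  obtain ⟨u, hu⟩ := T.exists_isTwoLevel h
  have := (hu.eq_or_eq t ht.2).resolve_left ht.1
  exact this ▸ hu

namespace IsTwoLevel

variable {T : LabelledTree n} {t : T.V}

theorem adj_leaf (h : T.IsTwoLevel t) (i : Fin n) :
    T.graph.Adj (T.leaf i) T.root ∨ T.graph.Adj (T.leaf i) t := by
  obtain ⟨w, hw⟩ := T.exists_neighborSet_leaf i
  have hadj : T.graph.Adj (T.leaf i) w := (hw ▸ rfl : w ∈ T.graph.neighborSet (T.leaf i))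
  have hwl : ¬ T.IsLeaf w := by
    rintro ⟨j, rfl⟩
    exact T.not_adj_leaf_leaf i j hadj
  rcases h.eq_or_eq w hwl with rfl | rfl
  · exact Or.inl hadj
  · exact Or.inr hadj

theorem adj_leaf_root_iff (h : T.IsTwoLevel t) (i : Fin n) :
    T.graph.Adj (T.leaf i) T.root ↔ ¬ T.graph.Adj (T.leaf i) t :=
  ⟨fun h1 h2 => h.isInternal.1 (T.eq_of_adj_leaf h2 h1), fun h1 => (h.adj_leaf i).resolve_right h1⟩

theorem mem_leavesBelow_iff (h : T.IsTwoLevel t) (i : Fin n) :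
    i ∈ T.leavesBelow t ↔ T.graph.Adj (T.leaf i) t := by
  have hne : T.leaf i ≠ T.root := fun he => T.not_isLeaf_root ⟨i, he⟩
  have hnt : T.leaf i ≠ t := fun he => h.isInternal.2 ⟨i, he⟩
  constructor
  · rintro ⟨p, hp⟩
    by_contra hadj
    have hr := (h.adj_leaf_root_iff i).2 hadj
    have : p = SimpleGraph.Path.singleton hr := (T.isTree.2.subsingleton_path _ _).elim _ _
    rw [this] at hp
    simp only [SimpleGraph.Path.singleton, SimpleGraph.Walk.support_cons,
      SimpleGraph.Walk.support_nil, List.mem_cons, List.not_mem_nil, or_false] at hp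
    rcases hp with hp | hp
    · exact hnt hp.symm
    · exact h.isInternal.1 hp
  · intro hadj
    refine ⟨⟨.cons hadj (.cons h.adj_root.symm .nil), ?_⟩, ?_⟩
    · simp [SimpleGraph.Walk.cons_isPath_iff, hne, hnt, h.isInternal.1]
    · simp

/-- The vertex `t` has degree at least three, and its only neighbour that is not a leaf is the root.
-/
theorem leavesBelow_nontrivial (h : T.IsTwoLevel t) : (T.leavesBelow t).Nontrivial := by
  have := T.finite
  by_contra hn
  rw [Set.not_nontrivial_iff] at hn
  have h3 := T.three_le_degree t h.isInternal.1 h.isInternal.2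
  have hsub : T.graph.neighborSet t ⊆ insert T.root (T.leaf '' T.leavesBelow t) := by
    intro v hv
    by_cases hl : T.IsLeaf v
    · obtain ⟨i, rfl⟩ := hl
      exact Or.inr ⟨i, (h.mem_leavesBelow_iff i).2 (T.graph.adj_symm hv), rfl⟩
    · rcases h.eq_or_eq v hl with rfl | rfl
      · exact Or.inl rfl
      · exact absurd hv (T.graph.irrefl)
  have h1 := Set.ncard_le_ncard hsub (Set.toFinite _)
  have h2 := Set.ncard_insert_le T.root (T.leaf '' T.leavesBelow t)
  have h4 : (T.leaf '' T.leavesBelow t).ncard ≤ 1 :=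
    Set.ncard_le_one_iff_subsingleton.2 (hn.image _)
  omega

/-- Otherwise `t` would be the only neighbour of the root. -/
theorem leavesBelow_ne_univ (h : T.IsTwoLevel t) : T.leavesBelow t ≠ Set.univ := by
  have := T.finite
  intro hu
  have h2 := T.two_le_degree_root
  have hsub : T.graph.neighborSet T.root ⊆ {t} := by
    intro v hv
    by_cases hl : T.IsLeaf v
    · obtain ⟨i, rfl⟩ := hl
      have hi : i ∈ T.leavesBelow t := hu ▸ trivial
      exact absurd ((h.mem_leavesBelow_iff i).1 hi)
        ((h.adj_leaf_root_iff i).1 (T.graph.adj_symm hv))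
    · rcases h.eq_or_eq v hl with rfl | rfl
      · exact absurd hv (T.graph.irrefl)
      · rfl
  have h1 := Set.ncard_le_ncard hsub (Set.toFinite _)
  rw [Set.ncard_singleton] at h1
  omega

theorem leavesBelow_eq_of_iso {U : LabelledTree n} {u : U.V} (hT : T.IsTwoLevel t)
    (hU : U.IsTwoLevel u) (h : T.Iso U) : T.leavesBelow t = U.leavesBelow u := by
  obtain ⟨e, hr, hl⟩ := h
  have het : e t = u := by
    refine (hU.eq_or_eq (e t) ?_).resolve_left ?_
    · rintro ⟨i, hi⟩
      rw [← hl] at hi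
      exact hT.isInternal.2 ⟨i, e.injective hi⟩
    · rw [← hr]
      exact fun he => hT.isInternal.1 (e.injective he)
  ext i
  rw [hT.mem_leavesBelow_iff, hU.mem_leavesBelow_iff, ← het, ← hl, e.map_adj_iff]

/-- The vertices of a two-level tree: the root, the internal vertex, and the leaves. -/
def vertex (T : LabelledTree n) (t : T.V) : Option (Option (Fin n)) → T.V
  | none => T.root
  | some none => t
  | some (some i) => T.leaf i

theorem vertex_bijective (h : T.IsTwoLevel t) : Function.Bijective (vertex T t) := by
  have h1 : ∀ i, T.leaf i ≠ T.root := fun i he => T.not_isLeaf_root ⟨i, he⟩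
  have h2 : ∀ i, T.leaf i ≠ t := fun i he => h.isInternal.2 ⟨i, he⟩
  constructor
  · rintro (_ | _ | i) (_ | _ | j) hij
    · rfl
    · exact absurd hij.symm h.isInternal.1
    · exact absurd hij.symm (h1 j)
    · exact absurd hij h.isInternal.1
    · rfl
    · exact absurd hij.symm (h2 j)
    · exact absurd hij (h1 i)
    · exact absurd hij (h2 i)
    · rw [T.leaf_injective hij]
  · intro v
    by_cases hl : T.IsLeaf v
    · obtain ⟨i, rfl⟩ := hl
      exact ⟨some (some i), rfl⟩
    · rcases h.eq_or_eq v hl with rfl | rfl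
      · exact ⟨none, rfl⟩
      · exact ⟨some none, rfl⟩

theorem iso_of_leavesBelow_eq {U : LabelledTree n} {u : U.V} (hT : T.IsTwoLevel t)
    (hU : U.IsTwoLevel u) (h : T.leavesBelow t = U.leavesBelow u) : T.Iso U := by
  have ht : ∀ i, T.graph.Adj (T.leaf i) t ↔ U.graph.Adj (U.leaf i) u := fun i => by
    rw [← hT.mem_leavesBelow_iff, ← hU.mem_leavesBelow_iff, h]
  have hr : ∀ i, T.graph.Adj (T.leaf i) T.root ↔ U.graph.Adj (U.leaf i) U.root := fun i => by
    rw [hT.adj_leaf_root_iff, hU.adj_leaf_root_iff, ht]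
  have key : ∀ a b, U.graph.Adj (vertex U u a) (vertex U u b) ↔
      T.graph.Adj (vertex T t a) (vertex T t b) := by
    rintro (_ | _ | i) (_ | _ | j)
    · exact iff_of_false U.graph.irrefl T.graph.irrefl
    · exact iff_of_true hU.adj_root hT.adj_root
    · exact (U.graph.adj_comm _ _).trans ((hr j).symm.trans (T.graph.adj_comm _ _))
    · exact iff_of_true hU.adj_root.symm hT.adj_root.symm
    · exact iff_of_false U.graph.irrefl T.graph.irrefl
    · exact (U.graph.adj_comm _ _).trans ((ht j).symm.trans (T.graph.adj_comm _ _))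
    · exact (hr i).symm
    · exact (ht i).symm
    · exact iff_of_false (U.not_adj_leaf_leaf i j) (T.not_adj_leaf_leaf i j)
  let eT := Equiv.ofBijective _ hT.vertex_bijective
  let eU := Equiv.ofBijective _ hU.vertex_bijective
  have he : ∀ a, eU (eT.symm (vertex T t a)) = vertex U u a := fun a =>
    congrArg eU (eT.symm_apply_apply a)
  refine ⟨⟨eT.symm.trans eU, ?_⟩, he none, fun i => he (some (some i))⟩
  intro v w
  obtain ⟨a, rfl⟩ := hT.vertex_bijective.2 v
  obtain ⟨b, rfl⟩ := hT.vertex_bijective.2 w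
  change U.graph.Adj (eU (eT.symm (vertex T t a))) (eU (eT.symm (vertex T t b))) ↔ _
  rw [he, he]
  exact key a b

end IsTwoLevel

/-- For a contraction onto a two-level tree, the leaves below the internal vertex are the leaves in
a set of vertices that is separated from the root by a single edge. -/
theorem IsContraction.exists_preconnected {T U : LabelledTree n} (h : T.IsContraction U) {u : U.V}
    (hu : U.IsTwoLevel u) : ∃ D : Set T.V, (T.graph.induce D).Preconnected ∧
      (T.graph.induce Dᶜ).Preconnected ∧ T.root ∉ D ∧ U.leavesBelow u = T.leaf ⁻¹' D := by
  obtain ⟨f, -, hr, hl, -, hfib, hadj⟩ := h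
  have hadj' : ∀ a b, U.graph.Adj a b → ∃ x y, f x = a ∧ f y = b ∧ T.graph.Adj x y :=
    fun a b hab => ((hadj a b).1 hab).2
  -- `S` is a star centred at `u` and its complement is a star centred at the root, so both
  -- preimages are connected.
  set S : Set U.V := {v | v = u ∨ (U.IsLeaf v ∧ U.graph.Adj v u)} with hS
  refine ⟨f ⁻¹' S, ?_, ?_, ?_, ?_⟩
  · refine SimpleGraph.preconnected_induce_preimage hfib hadj' ?_
    exact SimpleGraph.preconnected_induce_of_forall_adj (c := u) (Or.inl rfl)
      fun x hx => hx.imp id And.right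
  · rw [← Set.preimage_compl]
    refine SimpleGraph.preconnected_induce_preimage hfib hadj' ?_
    refine SimpleGraph.preconnected_induce_of_forall_adj (c := U.root) ?_ ?_
    · rintro (h | h)
      · exact hu.isInternal.1 h.symm
      · exact U.not_isLeaf_root h.1
    · intro x hx
      by_cases hxl : U.IsLeaf x
      · obtain ⟨i, rfl⟩ := hxl
        exact Or.inr ((hu.adj_leaf_root_iff i).2 fun h => hx (Or.inr ⟨⟨i, rfl⟩, h⟩))
      · exact Or.inl ((hu.eq_or_eq x hxl).resolve_right fun h => hx (Or.inl h))
  · rw [Set.mem_preimage, hr]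
    rintro (h | h)
    · exact hu.isInternal.1 h.symm
    · exact U.not_isLeaf_root h.1
  · ext i
    rw [hu.mem_leavesBelow_iff, Set.mem_preimage, Set.mem_preimage, hl]
    exact ⟨fun h => Or.inr ⟨⟨i, rfl⟩, h⟩, fun h => h.elim
      (fun h => absurd ⟨i, h⟩ hu.isInternal.2) And.right⟩

theorem IsContraction.laminar {T U U' : LabelledTree n} (h : T.IsContraction U)
    (h' : T.IsContraction U') {u : U.V} {u' : U'.V} (hu : U.IsTwoLevel u)
    (hu' : U'.IsTwoLevel u') :
    U.leavesBelow u ⊆ U'.leavesBelow u' ∨ U'.leavesBelow u' ⊆ U.leavesBelow u ∨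
      Disjoint (U.leavesBelow u) (U'.leavesBelow u') := by
  obtain ⟨D, hD1, hD2, hD3, hD⟩ := h.exists_preconnected hu
  obtain ⟨E, hE1, hE2, hE3, hE⟩ := h'.exists_preconnected hu'
  rw [hD, hE]
  rcases T.isTree.2.laminar_of_preconnected hD1 hD2 hE1 hE2 hD3 hE3 with h | h | h
  · exact Or.inl (Set.preimage_mono h)
  · exact Or.inr (Or.inl (Set.preimage_mono h))
  · exact Or.inr (Or.inr (h.preimage _))

end TwoLevel

end LabelledTree

/-! ### The identification of tree types with partitions -/

section TreePartition

variable {n : ℕ}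

open Classical in
/-- The partition whose only nontrivial block consists of the labels below the internal vertex of a
tree with one internal edge. -/
@[reducible]
noncomputable def treePartition (x : TreeType n) : PartitionLattice n :=
  -- The chosen representative does not matter, by `leavesBelow_eq_of_iso`. The value `⊥` is a
  -- default for types that are not vertices of the complex of trees.
  if h : ∃ p : (T : LabelledTree n) × T.V, p.1.type = x ∧ p.1.IsTwoLevel p.2 then
    blockPartition (h.choose.1.leavesBelow h.choose.2) else ⊥

theorem treePartition_type {T : LabelledTree n} {t : T.V} (h : T.IsTwoLevel t) :
    treePartition T.type = blockPartition (T.leavesBelow t) := by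
  have hex : ∃ p : (U : LabelledTree n) × U.V, p.1.type = T.type ∧ p.1.IsTwoLevel p.2 :=
    ⟨⟨T, t⟩, rfl, h⟩
  rw [treePartition, dif_pos hex]
  have hiso : hex.choose.1.Iso T := Quotient.exact hex.choose_spec.1
  rw [hex.choose_spec.2.leavesBelow_eq_of_iso h hiso]

theorem type_eq_of_treePartition_eq {T U : LabelledTree n} {t : T.V} {u : U.V}
    (hT : T.IsTwoLevel t) (hU : U.IsTwoLevel u)
    (h : treePartition T.type = treePartition U.type) : T.type = U.type := by
  rw [treePartition_type hT, treePartition_type hU] at h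
  exact Quotient.sound (hT.iso_of_leavesBelow_eq hU
    (blockPartition_injOn hT.leavesBelow_nontrivial hU.leavesBelow_nontrivial h))

theorem treePartition_injOn :
    Set.InjOn (treePartition (n := n)) {x | {x} ∈ (treeComplex n).faces} := by
  rintro x ⟨-, B, -, hx⟩ y ⟨-, C, -, hy⟩ h
  obtain ⟨T, -, hT1, rfl⟩ := hx (Finset.mem_coe.2 (Finset.mem_singleton_self x))
  obtain ⟨U, -, hU1, rfl⟩ := hy (Finset.mem_coe.2 (Finset.mem_singleton_self y))
  obtain ⟨t, ht⟩ := T.exists_isTwoLevel hT1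
  obtain ⟨u, hu⟩ := U.exists_isTwoLevel hU1
  exact type_eq_of_treePartition_eq ht hu h

theorem LabelledTree.isLaminar_image_simplex (T : LabelledTree n) :
    IsLaminar (treePartition '' T.simplex) := by
  constructor
  · rintro _ ⟨_, ⟨U, -, hU, rfl⟩, rfl⟩
    obtain ⟨u, hu⟩ := U.exists_isTwoLevel hU
    exact ⟨_, hu.leavesBelow_nontrivial, hu.leavesBelow_ne_univ, treePartition_type hu⟩
  · rintro A B ⟨_, ⟨U, hTU, hU, rfl⟩, hA⟩ ⟨_, ⟨W, hTW, hW, rfl⟩, hB⟩ hAn hBn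
    obtain ⟨u, hu⟩ := U.exists_isTwoLevel hU
    obtain ⟨w, hw⟩ := W.exists_isTwoLevel hW
    rw [treePartition_type hu] at hA
    rw [treePartition_type hw] at hB
    rw [← blockPartition_injOn hu.leavesBelow_nontrivial hAn hA,
      ← blockPartition_injOn hw.leavesBelow_nontrivial hBn hB]
    exact hTU.laminar hTW hu hw

end TreePartition

/-! ### Hierarchies, their trees, and the faces of the complex of trees -/

section Hierarchy

variable {n : ℕ}

/-- A laminar family of nonempty sets that contains the singletons and the whole set. -/
structure IsHierarchy (H : Set (Set (Fin n))) : Prop where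
  univ_mem : Set.univ ∈ H
  singleton_mem : ∀ i, {i} ∈ H
  nonempty : ∀ A ∈ H, A.Nonempty
  laminar : ∀ A ∈ H, ∀ B ∈ H, A ⊆ B ∨ B ⊆ A ∨ Disjoint A B

/-- `B` is the smallest member of `H` that properly contains `A`. -/
def IsParent (H : Set (Set (Fin n))) (A B : Set (Fin n)) : Prop :=
  A ⊂ B ∧ ∀ C ∈ H, A ⊂ C → B ⊆ C

namespace IsHierarchy

variable {H : Set (Set (Fin n))}

theorem subset_or_subset (h : IsHierarchy H) {A B : Set (Fin n)} (hA : A ∈ H) (hB : B ∈ H)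
    {i : Fin n} (hiA : i ∈ A) (hiB : i ∈ B) : A ⊆ B ∨ B ⊆ A := by
  rcases h.laminar A hA B hB with h | h | h
  · exact Or.inl h
  · exact Or.inr h
  · exact absurd hiB (h.notMem_of_mem_left hiA)

theorem exists_isParent (h : IsHierarchy H) {A : Set (Fin n)} (hA : A ∈ H) (hu : A ≠ Set.univ) :
    ∃ B ∈ H, IsParent H A B := by
  obtain ⟨B, hB⟩ := exists_minimal_of_wellFoundedLT (fun B => B ∈ H ∧ A ⊂ B)
    ⟨Set.univ, h.univ_mem, Set.ssubset_univ_iff.2 hu⟩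
  refine ⟨B, hB.prop.1, hB.prop.2, fun C hC hAC => ?_⟩
  obtain ⟨i, hi⟩ := h.nonempty A hA
  rcases h.subset_or_subset hB.prop.1 hC (hB.prop.2.1 hi) (hAC.1 hi) with h | h
  · exact h
  · exact hB.2 ⟨hC, hAC⟩ h

theorem exists_child (h : IsHierarchy H) {A : Set (Fin n)} (hA : A ∈ H) {i : Fin n} (hi : i ∈ A)
    (hne : A ≠ {i}) : ∃ B ∈ H, IsParent H B A ∧ i ∈ B := by
  obtain ⟨B, hB⟩ := exists_maximal_of_wellFoundedGT (fun B => B ∈ H ∧ B ⊂ A ∧ i ∈ B)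
    ⟨{i}, h.singleton_mem i, (Set.singleton_subset_iff.2 hi).ssubset_of_ne hne.symm, rfl⟩
  refine ⟨B, hB.prop.1, ⟨hB.prop.2.1, fun C hC hBC => ?_⟩, hB.prop.2.2⟩
  rcases h.subset_or_subset hA hC hi (hBC.1 hB.prop.2.2) with h | h
  · exact h
  · by_cases hCA : C = A
    · exact hCA.ge
    · exact absurd (hB.2 ⟨hC, h.ssubset_of_ne hCA, hBC.1 hB.prop.2.2⟩ hBC.1) hBC.2

end IsHierarchy

/-- The graph on a family of sets that connects each set to its parent. -/
def hierarchyGraph (H : Set (Set (Fin n))) : SimpleGraph H where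
  Adj A B := IsParent H A.1 B.1 ∨ IsParent H B.1 A.1
  symm := ⟨fun _ _ h => h.symm⟩
  loopless := ⟨fun A h => h.elim (fun h => ssubset_irrefl A.1 h.1) (fun h => ssubset_irrefl A.1 h.1)⟩

/-- Climbing from parent to parent inside `S` enlarges the set each time, so it ends, and it can end
only at `C`. -/
theorem hierarchyGraph_preconnected_induce {H : Set (Set (Fin n))} {S : Set H} {C : H} (hC : C ∈ S)
    (h : ∀ B ∈ S, B ≠ C → ∃ P ∈ S, IsParent H B.1 P.1) :
    ((hierarchyGraph H).induce S).Preconnected := by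
  have key : ∀ B : S, ((hierarchyGraph H).induce S).Reachable B ⟨C, hC⟩ := by
    intro B
    induction B using WellFoundedGT.induction with
    | ind B ih =>
      by_cases hBC : B.1 = C
      · have : B = ⟨C, hC⟩ := Subtype.ext hBC
        rw [this]
      · obtain ⟨P, hP, hBP⟩ := h B.1 B.2 hBC
        have hadj : ((hierarchyGraph H).induce S).Adj B ⟨P, hP⟩ := Or.inl hBP
        exact hadj.reachable.trans (ih ⟨P, hP⟩ hBP.1)
  exact fun x y => (key x).trans (key y).symm

namespace IsHierarchy

variable {H : Set (Set (Fin n))}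

theorem isTree_hierarchyGraph (h : IsHierarchy H) : (hierarchyGraph H).IsTree := by
  refine ⟨?_, ?_⟩
  · have : Nonempty H := ⟨⟨_, h.univ_mem⟩⟩
    refine ⟨?_⟩
    have hpre := hierarchyGraph_preconnected_induce (H := H) (S := Set.univ)
      (C := ⟨_, h.univ_mem⟩) trivial (fun B _ hB => by
        obtain ⟨P, hP, hBP⟩ := h.exists_isParent B.2 fun he => hB (Subtype.ext he)
        exact ⟨⟨P, hP⟩, trivial, hBP⟩)
    intro x y
    exact (hpre ⟨x, trivial⟩ ⟨y, trivial⟩).map (SimpleGraph.induceUnivIso _).toHom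
  · rw [SimpleGraph.isAcyclic_iff_forall_adj_isBridge]
    have key : ∀ A B : H, IsParent H A.1 B.1 →
        ¬ ((hierarchyGraph H).deleteEdges {s(A, B)}).Reachable A B := by
      intro A B hAB hr
      -- The only edge leaving the subsets of `A` joins `A` to its parent `B`; once it is deleted,
      -- they are closed under adjacency.
      have := hr.mem_of_adj_closed (S := {X : H | X.1 ⊆ A.1}) (by
        intro X hX Y hXY
        rw [SimpleGraph.deleteEdges_adj] at hXY
        obtain ⟨hXY | hXY, hne⟩ := hXY
        · rcases (show X.1 ⊆ A.1 from hX).eq_or_ssubset with he | hlt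
          · exfalso
            have hXA : X = A := Subtype.ext he
            subst hXA
            refine hne ?_
            have hYB : Y = B := Subtype.ext
              (Set.Subset.antisymm (hXY.2 _ B.2 hAB.1) (hAB.2 _ Y.2 hXY.1))
            rw [hYB]
            rfl
          · exact hXY.2 _ A.2 hlt
        · exact hXY.1.1.trans hX) (subset_refl A.1)
      exact hAB.1.2 this
    intro A B hAB
    rw [SimpleGraph.isBridge_iff]
    rcases hAB with hAB | hAB
    · exact key A B hAB
    · intro hr
      rw [Sym2.eq_swap] at hr
      exact key B A hAB hr.symm

/-- A child of `A` is a proper subset, so it misses some `j ∈ A`; the child containing `j` is a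
second one. -/
theorem exists_two_children (h : IsHierarchy H) {A : Set (Fin n)} (hA : A ∈ H)
    (hs : ∀ i, A ≠ {i}) :
    ∃ B ∈ H, ∃ C ∈ H, IsParent H B A ∧ IsParent H C A ∧ B ≠ C := by
  obtain ⟨i, hi⟩ := h.nonempty A hA
  obtain ⟨B, hB, hBA, -⟩ := h.exists_child hA hi (hs i)
  obtain ⟨j, hj, hjB⟩ := Set.exists_of_ssubset hBA.1
  obtain ⟨C, hC, hCA, hjC⟩ := h.exists_child hA hj (hs j)
  exact ⟨B, hB, C, hC, hBA, hCA, fun he => hjB (he ▸ hjC)⟩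

theorem two_le_ncard_neighborSet (h : IsHierarchy H) {A : H} (hs : ∀ i, A.1 ≠ {i}) :
    2 ≤ ((hierarchyGraph H).neighborSet A).ncard := by
  obtain ⟨B, hB, C, hC, hBA, hCA, hne⟩ := h.exists_two_children A.2 hs
  have hne' : (⟨B, hB⟩ : H) ≠ ⟨C, hC⟩ := fun he => hne (congrArg Subtype.val he)
  rw [← Set.ncard_pair hne']
  refine Set.ncard_le_ncard ?_ (Set.toFinite _)
  rintro X (rfl | rfl)
  · exact Or.inr hBA
  · exact Or.inr hCA

theorem three_le_ncard_neighborSet (h : IsHierarchy H) {A : H} (hs : ∀ i, A.1 ≠ {i})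
    (hu : A.1 ≠ Set.univ) : 3 ≤ ((hierarchyGraph H).neighborSet A).ncard := by
  obtain ⟨B, hB, C, hC, hBA, hCA, hne⟩ := h.exists_two_children A.2 hs
  obtain ⟨P, hP, hAP⟩ := h.exists_isParent A.2 hu
  have h1 : (⟨B, hB⟩ : H) ≠ ⟨C, hC⟩ := fun he => hne (congrArg Subtype.val he)
  have h2 : (⟨B, hB⟩ : H) ≠ ⟨P, hP⟩ := fun he =>
    (hBA.1.trans hAP.1).ne (congrArg Subtype.val he)
  have h3 : (⟨C, hC⟩ : H) ≠ ⟨P, hP⟩ := fun he =>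
    (hCA.1.trans hAP.1).ne (congrArg Subtype.val he)
  rw [← Set.ncard_eq_three.2 ⟨_, _, _, h1, h2, h3, rfl⟩]
  refine Set.ncard_le_ncard ?_ (Set.toFinite _)
  rintro X (rfl | rfl | rfl)
  · exact Or.inr hBA
  · exact Or.inr hCA
  · exact Or.inl hAP

theorem ncard_neighborSet_singleton (h : IsHierarchy H) (hn : 2 ≤ n) (i : Fin n) :
    ((hierarchyGraph H).neighborSet ⟨{i}, h.singleton_mem i⟩).ncard = 1 := by
  have : Nontrivial (Fin n) := Fin.nontrivial_iff_two_le.2 hn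
  obtain ⟨P, hP, hiP⟩ := h.exists_isParent (h.singleton_mem i) (Set.singleton_ne_univ i)
  rw [Set.ncard_eq_one]
  refine ⟨⟨P, hP⟩, Set.eq_singleton_iff_unique_mem.2 ⟨Or.inl hiP, ?_⟩⟩
  rintro X (hX | hX)
  · exact Subtype.ext (Set.Subset.antisymm (hX.2 _ hP hiP.1) (hiP.2 _ X.2 hX.1))
  · exact absurd (Set.ssubset_singleton_iff.1 hX.1) (h.nonempty _ X.2).ne_empty

/-- The tree of a hierarchy. -/
@[reducible]
def tree (h : IsHierarchy H) (hn : 2 ≤ n) : LabelledTree n where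
  V := H
  finite := inferInstance
  graph := hierarchyGraph H
  isTree := h.isTree_hierarchyGraph
  root := ⟨Set.univ, h.univ_mem⟩
  leaf i := ⟨{i}, h.singleton_mem i⟩
  leaf_injective _ _ hij := Set.singleton_injective (congrArg Subtype.val hij)
  degree_eq_one_iff A := by
    have : Nontrivial (Fin n) := Fin.nontrivial_iff_two_le.2 hn
    constructor
    · intro h1
      by_contra hl
      have := h.two_le_ncard_neighborSet (A := A) fun i hi => hl ⟨i, Subtype.ext hi.symm⟩
      omega
    · rintro ⟨i, rfl⟩
      exact h.ncard_neighborSet_singleton hn i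
  two_le_degree_root := by
    have : Nontrivial (Fin n) := Fin.nontrivial_iff_two_le.2 hn
    exact h.two_le_ncard_neighborSet fun i hi => Set.singleton_ne_univ i hi.symm
  three_le_degree A hA hl :=
    h.three_le_ncard_neighborSet (fun i hi => hl ⟨i, Subtype.ext hi.symm⟩)
      fun hu => hA (Subtype.ext hu)

/-- A member of `H` inside `A` is contained in `C`, disjoint from `C`, or properly contains `C` and
then all of `A`. So `A \ C` can be added without losing laminarity, and maximality puts it in `H`.
-/
theorem sdiff_mem_of_maximal (hH : Maximal IsHierarchy H) {A C : Set (Fin n)} (hA : A ∈ H)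
    (hC : C ∈ H) (hCA : IsParent H C A) : A \ C ∈ H := by
  have h := hH.prop
  have hlam : ∀ D ∈ H, D ⊆ A \ C ∨ A \ C ⊆ D ∨ Disjoint D (A \ C) := by
    intro D hD
    rcases h.laminar D hD A hA with h1 | h1 | h1
    · rcases h.laminar D hD C hC with h2 | h2 | h2
      · exact Or.inr (Or.inr (Set.disjoint_sdiff_right.mono_left h2))
      · rcases h2.eq_or_ssubset with rfl | h2
        · exact Or.inr (Or.inr Set.disjoint_sdiff_right)
        · exact Or.inr (Or.inl (Set.sdiff_subset.trans (hCA.2 D hD h2)))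
      · exact Or.inl (Set.subset_sdiff.2 ⟨h1, h2⟩)
    · exact Or.inr (Or.inl (Set.sdiff_subset.trans h1))
    · exact Or.inr (Or.inr (h1.mono_right Set.sdiff_subset))
  have hins : IsHierarchy (insert (A \ C) H) :=
    { univ_mem := Or.inr h.univ_mem
      singleton_mem := fun i => Or.inr (h.singleton_mem i)
      nonempty := by
        rintro B (rfl | hB)
        · exact Set.sdiff_nonempty.2 hCA.1.2
        · exact h.nonempty B hB
      laminar := by
        rintro B (rfl | hB) D (rfl | hD)
        · exact Or.inl subset_rfl
        · rcases hlam D hD with h | h | h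
          · exact Or.inr (Or.inl h)
          · exact Or.inl h
          · exact Or.inr (Or.inr h.symm)
        · exact hlam B hB
        · exact h.laminar B hB D hD }
  exact hH.2 hins (Set.subset_insert _ _) (Set.mem_insert _ _)

theorem eq_or_eq_sdiff (h : IsHierarchy H) {A B C : Set (Fin n)} (hB : B ∈ H) (hC : C ∈ H)
    (hD : A \ C ∈ H) (hBA : IsParent H B A) (hCA : IsParent H C A) : B = C ∨ B = A \ C := by
  by_contra! hne
  rcases h.laminar B hB C hC with h1 | h1 | h1
  · exact hCA.1.2 (hBA.2 C hC (h1.ssubset_of_ne hne.1))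
  · exact hBA.1.2 (hCA.2 B hB (h1.ssubset_of_ne hne.1.symm))
  · have h2 : B ⊂ A \ C := (Set.subset_sdiff.2 ⟨hBA.1.1, h1⟩).ssubset_of_ne hne.2
    obtain ⟨i, hi⟩ := h.nonempty C hC
    exact (hBA.2 _ hD h2 (hCA.1.1 hi)).2 hi

/-- A child `C` of `A` leaves room only for the child `A \ C`. This bounds the degrees from above;
the lower bounds hold in every labelled tree. -/
theorem isBinary_tree_of_maximal (hH : Maximal IsHierarchy H) (hn : 2 ≤ n) :
    (hH.prop.tree hn).IsBinary := by
  have h := hH.prop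
  have hchild : ∀ A : H, (∀ i, A.1 ≠ {i}) → ∃ C D : H, ∀ B : H, IsParent H B.1 A.1 →
      B = C ∨ B = D := by
    intro A hs
    obtain ⟨C, hC, -, -, hCA, -⟩ := h.exists_two_children A.2 hs
    have hD := sdiff_mem_of_maximal hH A.2 hC hCA
    exact ⟨⟨C, hC⟩, ⟨_, hD⟩, fun B hBA =>
      (h.eq_or_eq_sdiff B.2 hC hD hBA hCA).imp Subtype.ext Subtype.ext⟩
  have hpair : ∀ C D : H, ({C, D} : Set H).ncard ≤ 2 := fun C D =>
    (Set.ncard_insert_le C {D}).trans (by rw [Set.ncard_singleton])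
  constructor
  · refine le_antisymm ?_ (hH.prop.tree hn).two_le_degree_root
    obtain ⟨C, D, hCD⟩ := hchild (hH.prop.tree hn).root fun i hi =>
      (hH.prop.tree hn).not_isLeaf_root ⟨i, Subtype.ext hi.symm⟩
    refine (Set.ncard_le_ncard (t := {C, D}) ?_ (Set.toFinite _)).trans (hpair C D)
    rintro B (hB | hB)
    · exact absurd (Set.subset_univ _) hB.1.2
    · exact hCD B hB
  · rintro A ⟨hAr, hAl⟩
    refine le_antisymm ?_ ((hH.prop.tree hn).three_le_degree A hAr hAl)
    obtain ⟨C, D, hCD⟩ := hchild A fun i hi => hAl ⟨i, Subtype.ext hi.symm⟩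
    obtain ⟨P, hP, hAP⟩ := h.exists_isParent A.2 fun hu => hAr (Subtype.ext hu)
    refine (Set.ncard_le_ncard (t := {⟨P, hP⟩, C, D}) ?_ (Set.toFinite _)).trans ?_
    · rintro B (hB | hB)
      · exact Or.inl (Subtype.ext
          (Set.Subset.antisymm (hB.2 _ hP hAP.1) (hAP.2 _ B.2 hB.1)))
      · exact Or.inr (hCD B hB)
    · refine (Set.ncard_insert_le _ _).trans ?_
      have := hpair C D
      omega

theorem exists_hull (h : IsHierarchy H) {B : Set (Fin n)} (hB : B.Nonempty) :
    ∃ C ∈ H, B ⊆ C ∧ ∀ D ∈ H, B ⊆ D → C ⊆ D := by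
  obtain ⟨C, hC⟩ := exists_minimal_of_wellFoundedLT (fun C => C ∈ H ∧ B ⊆ C)
    ⟨Set.univ, h.univ_mem, Set.subset_univ _⟩
  refine ⟨C, hC.prop.1, hC.prop.2, fun D hD hBD => ?_⟩
  obtain ⟨i, hi⟩ := hB
  rcases h.subset_or_subset hC.prop.1 hD (hC.prop.2 hi) (hBD hi) with h | h
  · exact h
  · exact hC.2 ⟨hD, hBD⟩ h

/-- The contraction sends a cluster to its hull, the smallest member of `H'` containing it. A fibre
is connected because parents of a cluster smaller than its hull keep the same hull. -/
theorem isContraction_tree {H' : Set (Set (Fin n))} (h : IsHierarchy H) (h' : IsHierarchy H')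
    (hle : H' ⊆ H) (hn : 2 ≤ n) : (h.tree hn).IsContraction (h'.tree hn) := by
  choose g hgH hsub hmin using fun B : H => h'.exists_hull (h.nonempty B.1 B.2)
  let f : H → H' := fun B => ⟨g B, hgH B⟩
  have hf : ∀ (B : H) (C : H'), B.1 ⊆ C.1 → (∀ D ∈ H', B.1 ⊆ D → C.1 ⊆ D) → f B = C :=
    fun B C h1 h2 => Subtype.ext
      (Set.Subset.antisymm (hmin B _ C.2 h1) (h2 _ (hgH B) (hsub B)))
  have hfix : ∀ C : H', f ⟨C.1, hle C.2⟩ = C := fun C => hf _ _ subset_rfl fun D _ hD => hD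
  have hint : ∀ A B : H, IsParent H A.1 B.1 → f A = f B →
      ¬ (h.tree hn).IsLeaf A ∧ ¬ (h.tree hn).IsLeaf B := by
    intro A B hAB hfAB
    constructor
    · rintro ⟨i, rfl⟩
      have h1 : f ((h.tree hn).leaf i) = (h'.tree hn).leaf i := hfix ((h'.tree hn).leaf i)
      rw [h1] at hfAB
      have h2 : B.1 ⊆ {i} := (hsub B).trans (congrArg Subtype.val hfAB).ge
      exact hAB.1.2 h2
    · rintro ⟨i, rfl⟩
      exact (h.nonempty _ A.2).ne_empty (Set.ssubset_singleton_iff.1 hAB.1)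
  have hadj1 : ∀ a b : H', IsParent H' a.1 b.1 → ∃ x y : H, f x = a ∧ f y = b ∧
      IsParent H x.1 y.1 := by
    intro a b hab
    -- The edge is lifted to `a` and its parent `P` in the finer hierarchy, whose hull is `b`.
    obtain ⟨P, hP, haP⟩ := h.exists_isParent (hle a.2) (Set.ssubset_univ_iff.1
      (hab.1.trans_subset (Set.subset_univ _)))
    exact ⟨⟨a.1, hle a.2⟩, ⟨P, hP⟩, hfix a, hf _ _ (haP.2 _ (hle b.2) hab.1)
      fun D hD hPD => hab.2 D hD (haP.1.trans_subset hPD), haP⟩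
  have hadj2 : ∀ x y : H, f x ≠ f y → IsParent H x.1 y.1 → IsParent H' (f x).1 (f y).1 := by
    intro x y hne hxy
    -- If `x` were strictly inside its hull, its parent `y` would lie in that hull too and be merged
    -- with `x`.
    have hx : x.1 = (f x).1 := by
      by_contra hx
      have h1 : y.1 ⊆ (f x).1 := hxy.2 _ (hle (f x).2) ((hsub x).ssubset_of_ne hx)
      exact hne (hf x (f y) (hxy.1.1.trans (hsub y))
        fun D hD hxD => (hmin y _ (f x).2 h1).trans (hmin x D hD hxD))
    rw [← hx]
    exact ⟨hxy.1.trans_subset (hsub y), fun C hC hxC => hmin y C hC (hxy.2 C (hle hC) hxC)⟩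
  refine ⟨f, fun C => ⟨_, hfix C⟩, hfix (h'.tree hn).root, fun i => hfix ((h'.tree hn).leaf i),
    ?_, ?_, ?_⟩
  · intro A B hAB hfAB
    refine ⟨hAB, fun v hv => ?_⟩
    have hl : ¬ (h.tree hn).IsLeaf A ∧ ¬ (h.tree hn).IsLeaf B := by
      rcases hAB with hAB | hAB
      · exact hint A B hAB hfAB
      · exact (hint B A hAB hfAB.symm).symm
    rcases Sym2.mem_iff.1 hv with rfl | rfl
    · exact hl.1
    · exact hl.2
  · intro C
    refine hierarchyGraph_preconnected_induce (C := ⟨C.1, hle C.2⟩) (hfix C) ?_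
    rintro B hB hBC
    have hBC' : B.1 ⊂ C.1 := by
      refine Set.ssubset_iff_subset_ne.2 ⟨?_, fun he => hBC (Subtype.ext he)⟩
      exact (hsub B).trans (congrArg Subtype.val hB).le
    obtain ⟨P, hP, hBP⟩ := h.exists_isParent B.2 (Set.ssubset_univ_iff.1
      (hBC'.trans_subset (Set.subset_univ _)))
    refine ⟨⟨P, hP⟩, hf _ _ (hBP.2 _ (hle C.2) hBC') fun D hD hPD => ?_, hBP⟩
    have := hmin B D hD (hBP.1.1.trans hPD)
    exact (congrArg Subtype.val hB).ge.trans this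
  · intro a b
    constructor
    · intro hab
      refine ⟨hab.ne, ?_⟩
      rcases hab with hab | hab
      · obtain ⟨x, y, hx, hy, hxy⟩ := hadj1 a b hab
        exact ⟨x, y, hx, hy, Or.inl hxy⟩
      · obtain ⟨x, y, hx, hy, hxy⟩ := hadj1 b a hab
        exact ⟨y, x, hy, hx, Or.inr hxy⟩
    · rintro ⟨hne, x, y, rfl, rfl, hxy | hxy⟩
      · exact Or.inl (hadj2 x y hne hxy)
      · exact Or.inr (hadj2 y x hne.symm hxy)

end IsHierarchy

/-- The hierarchy with a single cluster `A` besides the trivial ones. -/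
def clusterHierarchy (A : Set (Fin n)) : Set (Set (Fin n)) :=
  {B | B = Set.univ ∨ B = A ∨ ∃ i, B = {i}}

theorem isHierarchy_of_laminar {S : Set (Set (Fin n))} (hn : 2 ≤ n)
    (hne : ∀ A ∈ S, A.Nonempty) (hS : ∀ A ∈ S, ∀ B ∈ S, A ⊆ B ∨ B ⊆ A ∨ Disjoint A B) :
    IsHierarchy {B | B = Set.univ ∨ B ∈ S ∨ ∃ i, B = {i}} := by
  have hsing : ∀ (i : Fin n) (B : Set (Fin n)), {i} ⊆ B ∨ Disjoint {i} B := by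
    intro i B
    by_cases hi : i ∈ B
    · exact Or.inl (Set.singleton_subset_iff.2 hi)
    · exact Or.inr (Set.disjoint_singleton_left.2 hi)
  have : Nontrivial (Fin n) := Fin.nontrivial_iff_two_le.2 hn
  refine ⟨Or.inl rfl, fun i => Or.inr (Or.inr ⟨i, rfl⟩), ?_, ?_⟩
  · rintro B (rfl | hB | ⟨i, rfl⟩)
    · exact Set.univ_nonempty
    · exact hne B hB
    · exact Set.singleton_nonempty i
  · rintro B (rfl | hB | ⟨i, rfl⟩) C hC
    · exact Or.inr (Or.inl (Set.subset_univ _))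
    · rcases hC with rfl | hC | ⟨i, rfl⟩
      · exact Or.inl (Set.subset_univ _)
      · exact hS B hB C hC
      · exact Or.inr ((hsing i B).imp id fun h => h.symm)
    · exact (hsing i C).imp id Or.inr

theorem isHierarchy_clusterHierarchy {A : Set (Fin n)} (hn : 2 ≤ n) (hA : A.Nonempty) :
    IsHierarchy (clusterHierarchy A) := by
  refine isHierarchy_of_laminar (S := {A}) hn ?_ ?_
  · rintro _ rfl
    exact hA
  · rintro _ rfl _ rfl
    exact Or.inl subset_rfl

theorem LabelledTree.IsTwoLevel.ncard_internalEdges {T : LabelledTree n} {t : T.V}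
    (h : T.IsTwoLevel t) : T.internalEdges.ncard = 1 := by
  rw [Set.ncard_eq_one]
  refine ⟨s(T.root, t), Set.eq_singleton_iff_unique_mem.2 ⟨⟨h.adj_root, ?_⟩, ?_⟩⟩
  · intro v hv
    rcases Sym2.mem_iff.1 hv with rfl | rfl
    · exact T.not_isLeaf_root
    · exact h.isInternal.2
  · intro e he
    induction e using Sym2.ind with
    | _ a b =>
      have hadj : T.graph.Adj a b := he.1
      rcases h.eq_or_eq a (he.2 a (Sym2.mem_mk_left a b)) with rfl | rfl <;>
        rcases h.eq_or_eq b (he.2 b (Sym2.mem_mk_right _ b)) with rfl | rfl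
      · exact absurd hadj T.graph.irrefl
      · rfl
      · exact Sym2.eq_swap
      · exact absurd hadj T.graph.irrefl

section Cluster

variable {A : Set (Fin n)} (hn : 2 ≤ n) (hA : A.Nontrivial) (hu : A ≠ Set.univ)
include hA hu

theorem isTwoLevel_clusterHierarchy :
    ((isHierarchy_clusterHierarchy hn hA.nonempty).tree hn).IsTwoLevel ⟨A, Or.inr (Or.inl rfl)⟩ := by
  refine ⟨⟨fun h => hu (congrArg Subtype.val h), ?_⟩, ?_, ?_⟩
  · rintro ⟨i, hi⟩
    exact hA.ne_singleton (congrArg Subtype.val hi).symm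
  · refine Or.inr ⟨Set.ssubset_univ_iff.2 hu, ?_⟩
    rintro C (rfl | rfl | ⟨i, rfl⟩) hC
    · exact subset_rfl
    · exact absurd hC (ssubset_irrefl _)
    · exact absurd (Set.ssubset_singleton_iff.1 hC) hA.nonempty.ne_empty
  · rintro ⟨B, rfl | rfl | ⟨i, rfl⟩⟩ hB
    · exact Or.inl rfl
    · exact Or.inr rfl
    · exact absurd ⟨i, rfl⟩ hB

theorem leavesBelow_clusterHierarchy :
    ((isHierarchy_clusterHierarchy hn hA.nonempty).tree hn).leavesBelow
      ⟨A, Or.inr (Or.inl rfl)⟩ = A := by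
  ext i
  rw [(isTwoLevel_clusterHierarchy hn hA hu).mem_leavesBelow_iff]
  constructor
  · rintro (h | h)
    · exact h.1.1 rfl
    · exact absurd (Set.ssubset_singleton_iff.1 h.1) hA.nonempty.ne_empty
  · intro hi
    refine Or.inl ⟨(Set.singleton_subset_iff.2 hi).ssubset_of_ne hA.ne_singleton.symm, ?_⟩
    rintro C (rfl | rfl | ⟨j, rfl⟩) hC
    · exact Set.subset_univ _
    · exact subset_rfl
    · exact absurd (Set.ssubset_singleton_iff.1 hC) (Set.singleton_ne_empty i)

end Cluster

/-- The blocks with the singletons and the whole set form a hierarchy, and a maximal one above it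
has a binary tree. Each block `A` is a vertex of its simplex, by contraction onto the tree of
`clusterHierarchy A`. -/
theorem exists_isBinary_subset_image_simplex (hn : 2 ≤ n) {s : Set (PartitionLattice n)}
    (hs : IsLaminar s) : ∃ B : LabelledTree n, B.IsBinary ∧ s ⊆ treePartition '' B.simplex := by
  have h0 := isHierarchy_of_laminar (S := {A : Set (Fin n) | A.Nontrivial ∧ blockPartition A ∈ s})
    hn (fun A hA => hA.1.nonempty) (fun A hA B hB => hs.2 A B hA.2 hB.2 hA.1 hB.1)
  obtain ⟨H, hle, hH⟩ := exists_maximal_ge_of_wellFoundedGT IsHierarchy _ h0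
  refine ⟨hH.prop.tree hn, IsHierarchy.isBinary_tree_of_maximal hH hn, fun X hX => ?_⟩
  obtain ⟨A, hA, hu, rfl⟩ := hs.1 X hX
  have h2 := isTwoLevel_clusterHierarchy hn hA hu
  refine ⟨_, ⟨_, IsHierarchy.isContraction_tree hH.prop
    (isHierarchy_clusterHierarchy hn hA.nonempty) ?_ hn, h2.ncard_internalEdges, rfl⟩, ?_⟩
  · rintro B (rfl | rfl | ⟨i, rfl⟩)
    · exact hH.prop.univ_mem
    · exact hle (Or.inr (Or.inl ⟨hA, hX⟩))
    · exact hH.prop.singleton_mem i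
  · rw [treePartition_type h2, leavesBelow_clusterHierarchy hn hA hu]

theorem mem_faces_relabel_treeComplex (hn : 2 ≤ n) (s : Finset (PartitionLattice n)) :
    s ∈ ((treeComplex n).relabel treePartition).faces ↔
      s.Nonempty ∧ IsLaminar (s : Set (PartitionLattice n)) := by
  classical
  constructor
  · rintro ⟨t, ⟨htne, B, -, htB⟩, rfl⟩
    refine ⟨htne.image _, ?_⟩
    have hB := B.isLaminar_image_simplex
    have hsub : ((Finset.image treePartition t : Finset (PartitionLattice n)) :
        Set (PartitionLattice n)) ⊆ treePartition '' B.simplex := by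
      rw [Finset.coe_image]
      exact Set.image_mono htB
    have hlam : IsLaminar ((Finset.image treePartition t : Finset (PartitionLattice n)) :
        Set (PartitionLattice n)) :=
      ⟨fun X hX => hB.1 X (hsub hX), fun A C hA hC => hB.2 A C (hsub hA) (hsub hC)⟩
    convert hlam
  · rintro ⟨hne, hs⟩
    obtain ⟨B, hB, hsB⟩ := exists_isBinary_subset_image_simplex hn hs
    obtain ⟨t, htB, ht⟩ := Finset.subset_set_image_iff.1 hsB
    refine ⟨t, ⟨?_, B, hB, htB⟩, ?_⟩
    · rw [← ht] at hne
      exact Finset.image_nonempty.1 hne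
    · rw [← ht]

end Hierarchy

/-- The order complex of the partition lattice is obtained from the complex of trees by stellar
subdivisions. The map `φ` identifies the vertices of the complex of trees with partitions: a tree
with one internal edge corresponds to the partition whose only nontrivial block is the set of
leaves below the internal vertex. -/
theorem mainTheorem2 (n : ℕ) (hn : 3 ≤ n) :
    ∃ φ : TreeType n → PartitionLattice n,
      (∀ T : LabelledTree n, T.internalEdges.ncard = 1 →
        ∀ t : T.V, T.IsInternal t → φ T.type = blockPartition (T.leavesBelow t)) ∧
      Set.InjOn φ {x | {x} ∈ (treeComplex n).faces} ∧
      (∃ l : List (PartitionLattice n), IsOppositeLinearExtension l) ∧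
      ∀ l : List (PartitionLattice n), IsOppositeLinearExtension l →
        IsStellarSequence ((treeComplex n).relabel φ)
          (l.map fun X => (irreducibleFactors X, X))
          (orderComplex (PartitionLattice n)) := by
  have hn2 : 2 ≤ n := by omega
  have : Nontrivial (Fin n) := Fin.nontrivial_iff_two_le.2 hn2
  refine ⟨treePartition, fun T hT t ht => treePartition_type (T.isTwoLevel_of_isInternal hT ht),
    treePartition_injOn, exists_isOppositeLinearExtension, ?_⟩
  rintro l ⟨hnd, hl, hp⟩
  have htop : IsIrreducibleElement (⊤ : PartitionLattice n) :=
    isIrreducibleElement_iff.2 ⟨Set.univ, Set.nontrivial_univ, blockPartition_univ.symm⟩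
  -- The induction starts with `G` the set of irreducible elements, where upward closure of the
  -- reducible part is vacuous.
  exact isStellarSequence_orderComplex (hasFactorization_partitionLattice n) htop l
    {X | IsIrreducibleElement X} _ (fun _ h => h) (fun Y hY hYI => absurd hY hYI)
    (fun h => h.1 rfl)
    (fun s => by rw [mem_faces_relabel_treeComplex hn2, isNested_irreducible_iff])
    hnd hl hp
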